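/- **Theorem 1.3 (polar dual of a free Hilbert spectrahedron).** Let $\mathscr H,\mathscr K$ be separable real Hilbert spaces and let $A=(A_1,\dots,A_g)$ be a tuple of bounded self-adjoint operators on $\mathscr H$. For a tuple $X$ of bounded operators on a real Hilbert space $W$ put $L_A(X)=I\otimes I+\sum_{j=1}^g A_j\otimes X_j$, an operator on the Hilbert space tensor product $\mathscr H\otimes W$ (and similarly for other tuples). For a closed subspace $K\subseteq\mathscr K$ let $$D_{L_A}(K)=\{X \text{ a } g\text{-tuple of self-adjoint operators on } K:\ L_A(X)\succeq 0\},\qquad D_{L_A}^{\mathscr K}=(D_{L_A}(K))_{K}.$$ The operator free Hilbert polar dual $(D_{L_A}^{\mathscr K})^{\mathscr K,\circ}$ has at the closed subspace $K\subseteq \mathscr K$ the level $$\{B \text{ a } g\text{-tuple of self-adjoint operators on } K:\ L_B(Y)\succeq 0 \text{ for every closed subspace } K'\subseteq\mathscr K \text{ and every } Y\in D_{L_A}(K')\}.$$ For a real Hilbert space $W$ let $\operatorname{oper-conv}_W\{A\}$ be the set of all tuples $$V^*\pi(A)V=(V^*\pi(A_1)V,\dots,V^*\pi(A_g)V),$$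 where $\mathscr G$ is a (not necessarily separable) real Hilbert space, $V:W\to\mathscr G$ is a contraction and $\pi:B(\mathscr H)\to B(\mathscr G)$ is a unital $*$-homomorphism. Then: 1. The operator free Hilbert polar dual of $D_{L_A}^{\mathscr K}$ is the operator Hilbert convex hull of $A$: its level at $\mathscr K$ equals $\operatorname{oper-conv}_{\mathscr K}\{A\}$, and for every closed subspace $K\subseteq\mathscr K$ its level at $K$ equals $\operatorname{oper-conv}_{K}\{A\}$. 2. The space $\mathscr G$ can be taken separable if $\pi$ is only required to be defined on a separable algebra: for every norm-closed, norm-separable unital $*$-subalgebra $\mathcal A\subseteq B(\mathscr H)$ containing $A_1,\dots,A_g$ (for instance $\mathcal A=B(\mathscr H)$ if $\dim\mathscr H<\infty$, or the unital $C^*$-algebra generated by $A_1,\dots,A_g$), the level at $\mathscr K$ of the polar dual equals the set of all tuples $V^*\pi(A)V$ with $\mathscr G$ a separable real Hilbert space, $V:\mathscr K\to\mathscr G$ a contraction and $\pi:\mathcal A\to B(\mathscr G)$ a unital $*$-homomorphism. 3. The set $\operatorname{oper-conv}_{\mathscr K}\{A\}\subseteq B(\mathscr K)^g$ is closed in the weak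 operator topology. -/

import Mathlib

open scoped TensorProduct

noncomputable section

/-- A closed subspace of a Hilbert space is a Hilbert space. -/
instance ClosedSubmodule.instCompleteSpaceToSubmodule {E : Type*} [NormedAddCommGroup E]
    [InnerProductSpace ℝ E] [CompleteSpace E] (K : ClosedSubmodule ℝ E) :
    CompleteSpace K.toSubmodule :=
  K.isClosed'.isComplete.completeSpace_coe

/-- The Hilbert space tensor product of two real Hilbert spaces: the completion of the algebraic
tensor product in the norm of the inner product `⟪x ⊗ y, x' ⊗ y'⟫ = ⟪x, x'⟫ * ⟪y, y'⟫`. -/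
abbrev HilbertTensor (E F : Type*) [NormedAddCommGroup E] [InnerProductSpace ℝ E]
    [NormedAddCommGroup F] [InnerProductSpace ℝ F] : Type _ :=
  UniformSpace.Completion (E ⊗[ℝ] F)

/-- The operator `S ⊗ T` on the Hilbert space tensor product. -/
def opTensor {E F : Type*} [NormedAddCommGroup E] [InnerProductSpace ℝ E]
    [NormedAddCommGroup F] [InnerProductSpace ℝ F] (S : E →L[ℝ] E) (T : F →L[ℝ] F) :
    HilbertTensor E F →L[ℝ] HilbertTensor E F :=
  (TensorProduct.mapL S T).completion

/-- The evaluation `L_A(X) = I ⊗ I + ∑ j, A j ⊗ X j` of the monic linear pencil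
`L_A(x) = I + ∑ j, A j * x j` at a tuple `X` of operators. -/
def monicPencilEval {g : ℕ} {E F : Type*} [NormedAddCommGroup E] [InnerProductSpace ℝ E]
    [NormedAddCommGroup F] [InnerProductSpace ℝ F]
    (A : Fin g → E →L[ℝ] E) (X : Fin g → F →L[ℝ] F) :
    HilbertTensor E F →L[ℝ] HilbertTensor E F :=
  opTensor (ContinuousLinearMap.id ℝ E) (ContinuousLinearMap.id ℝ F) +
    ∑ j, opTensor (A j) (X j)

/-- A collection `Γ = (Γ(K))_K`, indexed by the closed subspaces `K` of `𝒦`, of sets of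
`g`-tuples of bounded operators on `K`. -/
abbrev OperatorFamily (g : ℕ) (𝒦 : Type*) [NormedAddCommGroup 𝒦] [InnerProductSpace ℝ 𝒦] :
    Type _ :=
  ∀ K : ClosedSubmodule ℝ 𝒦, Set (Fin g → K.toSubmodule →L[ℝ] K.toSubmodule)

/-- The operator free Hilbert spectrahedron `D_{L_A}^𝒦`: at a closed subspace `K` of `𝒦` it
consists of the tuples `X` of self-adjoint operators on `K` with `L_A(X) ⪰ 0`. -/
def operSpectrahedron {g : ℕ} {H : Type*} [NormedAddCommGroup H] [InnerProductSpace ℝ H]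
    (A : Fin g → H →L[ℝ] H) (𝒦 : Type*) [NormedAddCommGroup 𝒦] [InnerProductSpace ℝ 𝒦]
    [CompleteSpace 𝒦] : OperatorFamily g 𝒦 :=
  fun _ => {X | (∀ j, IsSelfAdjoint (X j)) ∧ (monicPencilEval A X).IsPositive}

/-- The level of the polar dual of `Γ` at a Hilbert space `W`: the tuples `B` of self-adjoint
operators on `W` with `L_B(Y) ⪰ 0` for all `Y` in `Γ`, that is, for all closed subspaces `K` of
`𝒦` and all `Y ∈ Γ(K)`. -/
def polarDualAt {g : ℕ} {𝒦 : Type*} [NormedAddCommGroup 𝒦] [InnerProductSpace ℝ 𝒦]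
    (Γ : OperatorFamily g 𝒦) (W : Type*) [NormedAddCommGroup W] [InnerProductSpace ℝ W]
    [CompleteSpace W] : Set (Fin g → W →L[ℝ] W) :=
  {B | (∀ j, IsSelfAdjoint (B j)) ∧
    ∀ K : ClosedSubmodule ℝ 𝒦, ∀ Y ∈ Γ K, (monicPencilEval B Y).IsPositive}

/-- The operator free Hilbert polar dual of `Γ`, as a collection indexed by the closed subspaces
of `𝒦`. -/
def operPolarDual {g : ℕ} {𝒦 : Type*} [NormedAddCommGroup 𝒦] [InnerProductSpace ℝ 𝒦]
    [CompleteSpace 𝒦] (Γ : OperatorFamily g 𝒦) : OperatorFamily g 𝒦 :=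
  fun K => polarDualAt Γ K.toSubmodule

universe u v

/-- The operator Hilbert convex hull of `A` at a Hilbert space `W`: all tuples `V* π(A) V`, where
`G` is a real Hilbert space, `V : W → G` is a contraction and `π : B(H) → B(G)` is a unital
`*`-homomorphism. -/
def operConv {g : ℕ} {H : Type u} [NormedAddCommGroup H] [InnerProductSpace ℝ H]
    [CompleteSpace H] (A : Fin g → H →L[ℝ] H) (W : Type v) [NormedAddCommGroup W]
    [InnerProductSpace ℝ W] [CompleteSpace W] : Set (Fin g → W →L[ℝ] W) :=
  {X | ∃ (G : Type (max u v)) (_ : NormedAddCommGroup G) (_ : InnerProductSpace ℝ G)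
    (_ : CompleteSpace G) (π : (H →L[ℝ] H) →⋆ₐ[ℝ] (G →L[ℝ] G)) (V : W →L[ℝ] G),
    ‖V‖ ≤ 1 ∧ ∀ j, X j = (ContinuousLinearMap.adjoint V).comp ((π (A j)).comp V)}

/-- The variant of the hull for a tuple `a` in a unital `*`-subalgebra `𝒜` of `B(H)`: all tuples
`V* π(a) V`, where `G` is a separable real Hilbert space, `V : W → G` is a contraction and
`π : 𝒜 → B(G)` is a unital `*`-homomorphism. -/
def separableOperConv {g : ℕ} {H : Type u} [NormedAddCommGroup H] [InnerProductSpace ℝ H]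
    [CompleteSpace H] (𝒜 : StarSubalgebra ℝ (H →L[ℝ] H)) (a : Fin g → 𝒜) (W : Type v)
    [NormedAddCommGroup W] [InnerProductSpace ℝ W] [CompleteSpace W] :
    Set (Fin g → W →L[ℝ] W) :=
  {X | ∃ (G : Type (max u v)) (_ : NormedAddCommGroup G) (_ : InnerProductSpace ℝ G)
    (_ : CompleteSpace G) (_ : TopologicalSpace.SeparableSpace G)
    (π : 𝒜 →⋆ₐ[ℝ] (G →L[ℝ] G)) (V : W →L[ℝ] G),
    ‖V‖ ≤ 1 ∧ ∀ j, X j = (ContinuousLinearMap.adjoint V).comp ((π (a j)).comp V)}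

/-- A set of tuples of operators on `W` is closed in the weak operator topology (the product of
the weak operator topologies on the coordinates). -/
def IsWOTClosed {g : ℕ} {W : Type*} [NormedAddCommGroup W] [InnerProductSpace ℝ W]
    (S : Set (Fin g → W →L[ℝ] W)) : Prop :=
  IsClosed {X : Fin g → (W →WOT[ℝ] W) | (fun j => (X j).toCLM) ∈ S}

end

noncomputable section

open scoped Matrix

/-! ### Reduction of pencil positivity to matrix coefficients -/

section Positivity

variable {g : ℕ} {E F : Type*} [NormedAddCommGroup E] [InnerProductSpace ℝ E]
    [NormedAddCommGroup F] [InnerProductSpace ℝ F]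

/-! Only finitely many vectors of the coefficient space enter an algebraic tensor, so positivity of
a pencil amounts to scalar inequalities with symmetric matrix coefficients `Y`, expressed by
`PencilFormNonneg`. The polar condition becomes: nonnegativity for `A` implies nonnegativity for
`B`.

The hull lies in the polar dual because a unital `*`-homomorphism of a closed operator algebra is
completely positive (`sum_inner_map_nonneg`) and compression by a contraction can only enlarge the
identity term.

Conversely, a congruence homogenizes the polar condition, replacing the identity coefficient by any
matrix `t` that is positive semidefinite over `ℝ` (`gramSum_nonneg_of_pencilFormNonneg`). A
coefficient tuple is then read as a function on pairs of linear maps `W → H`, `W → ℝ`. The second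
map is what detects positivity of `t`; it adds a zero summand to `A`, and is the reason that `V` is
a contraction and not an isometry. The tuple `B` defines a linear functional that is nonnegative on
the nonnegative functions of this kind, and the Riesz extension theorem extends it to a positive
functional on all functions dominated by quadratic forms (`exists_positive_functional`). These
include `⟪a (x w), b (x w')⟫` for all `a`, `b` in the algebra, so a GNS construction on `𝒜 ⊗ W`
yields `π` and `V` (`exists_dilation`).

Separability of the GNS space follows from density of the vectors `π b (V w)`, and weak closedness
from the fact that the polar dual is cut out by weakly continuous inequalities. -/

/-- The quadratic form of the pencil `I + ∑ j, A j ⊗ Y j` with matrix coefficients `Y j` is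
nonnegative. -/
def PencilFormNonneg {n : ℕ} (A : Fin g → E →L[ℝ] E) (Y : Fin g → Matrix (Fin n) (Fin n) ℝ) :
    Prop :=
  ∀ h : Fin n → E,
    0 ≤ ∑ i, inner ℝ (h i) (h i) + ∑ j, ∑ i, ∑ k, Y j i k * inner ℝ (A j (h i)) (h k)


theorem opTensor_coe (S : E →L[ℝ] E) (T : F →L[ℝ] F) (ξ : E ⊗[ℝ] F) :
    opTensor S T (ξ : HilbertTensor E F) =
      ((TensorProduct.map (S : E →ₗ[ℝ] E) (T : F →ₗ[ℝ] F) ξ : E ⊗[ℝ] F) : HilbertTensor E F) := by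
  simp [opTensor]

theorem monicPencilEval_coe (A : Fin g → E →L[ℝ] E) (X : Fin g → F →L[ℝ] F) (ξ : E ⊗[ℝ] F) :
    monicPencilEval A X (ξ : HilbertTensor E F) =
      ((ξ + ∑ j, TensorProduct.map (A j : E →ₗ[ℝ] E) (X j : F →ₗ[ℝ] F) ξ : E ⊗[ℝ] F) :
        HilbertTensor E F) := by
  have : ((∑ j, TensorProduct.map (A j : E →ₗ[ℝ] E) (X j : F →ₗ[ℝ] F) ξ : E ⊗[ℝ] F) :
        HilbertTensor E F) = ∑ j, ((TensorProduct.map (A j : E →ₗ[ℝ] E) (X j : F →ₗ[ℝ] F) ξ :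
          E ⊗[ℝ] F) : HilbertTensor E F) :=
    map_sum (UniformSpace.Completion.toCompl : E ⊗[ℝ] F →+ HilbertTensor E F) _ _
  rw [UniformSpace.Completion.coe_add, this]
  simp [monicPencilEval, opTensor_coe]

theorem inner_map_tensor_symm {S : E →L[ℝ] E} {T : F →L[ℝ] F}
    (hS : ∀ x y, inner ℝ (S x) y = inner ℝ x (S y)) (hT : ∀ x y, inner ℝ (T x) y = inner ℝ x (T y))
    (ξ η : E ⊗[ℝ] F) :
    inner ℝ (TensorProduct.map (S : E →ₗ[ℝ] E) (T : F →ₗ[ℝ] F) ξ) η =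
      inner ℝ ξ (TensorProduct.map (S : E →ₗ[ℝ] E) (T : F →ₗ[ℝ] F) η) := by
  induction ξ using TensorProduct.induction_on with
  | zero => simp
  | add x y hx hy => rw [map_add, inner_add_left, inner_add_left, hx, hy]
  | tmul x y =>
    induction η using TensorProduct.induction_on with
    | zero => simp
    | add x y hx hy => rw [map_add, inner_add_right, inner_add_right, hx, hy]
    | tmul x' y' => simp [hS, hT]

/-- Positivity of the evaluation of a pencil can be tested on the algebraic tensor product. -/
theorem isPositive_monicPencilEval_iff {A : Fin g → E →L[ℝ] E} {X : Fin g → F →L[ℝ] F}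
    (hA : ∀ j x y, inner ℝ (A j x) y = inner ℝ x (A j y))
    (hX : ∀ j x y, inner ℝ (X j x) y = inner ℝ x (X j y)) :
    (monicPencilEval A X).IsPositive ↔ ∀ ξ : E ⊗[ℝ] F,
      0 ≤ inner ℝ ξ ξ +
        ∑ j, inner ℝ (TensorProduct.map (A j : E →ₗ[ℝ] E) (X j : F →ₗ[ℝ] F) ξ) ξ := by
  rw [ContinuousLinearMap.isPositive_iff]
  constructor
  · rintro ⟨-, h⟩ ξ
    have := h (ξ : HilbertTensor E F)
    rwa [monicPencilEval_coe, UniformSpace.Completion.inner_coe, inner_add_left, sum_inner] at this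
  · intro h
    refine ⟨fun x y => ?_, fun x => ?_⟩
    · induction x, y using UniformSpace.Completion.induction_on₂ with
      | hp => exact isClosed_eq (by simp only [ContinuousLinearMap.coe_coe]; fun_prop)
                (by simp only [ContinuousLinearMap.coe_coe]; fun_prop)
      | ih ξ η =>
        simp only [ContinuousLinearMap.coe_coe, monicPencilEval_coe,
          UniformSpace.Completion.inner_coe, inner_add_left, inner_add_right, sum_inner, inner_sum]
        simp only [fun j => inner_map_tensor_symm (hA j) (hX j) ξ η]
    · induction x using UniformSpace.Completion.induction_on with
      | hp => exact isClosed_le (by fun_prop) (by fun_prop)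
      | ih ξ =>
        rw [monicPencilEval_coe, UniformSpace.Completion.inner_coe, inner_add_left, sum_inner]
        exact h ξ

theorem pencil_quadratic_form_sum {n : ℕ} {A : Fin g → E →L[ℝ] E} {X : Fin g → F →L[ℝ] F}
    {e : Fin n → F} (he : Orthonormal ℝ e) (h : Fin n → E) :
    inner ℝ (∑ i, h i ⊗ₜ[ℝ] e i) (∑ i, h i ⊗ₜ[ℝ] e i) + ∑ j, inner ℝ
        (TensorProduct.map (A j : E →ₗ[ℝ] E) (X j : F →ₗ[ℝ] F) (∑ i, h i ⊗ₜ[ℝ] e i))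
        (∑ i, h i ⊗ₜ[ℝ] e i) =
      ∑ i, inner ℝ (h i) (h i) +
        ∑ j, ∑ i, ∑ k, inner ℝ (X j (e i)) (e k) * inner ℝ (A j (h i)) (h k) := by
  congr 1
  · simp [sum_inner, inner_sum, orthonormal_iff_ite.1 he]
  · simp only [map_sum, TensorProduct.map_tmul, sum_inner, inner_sum, TensorProduct.inner_tmul,
      ContinuousLinearMap.coe_coe]
    exact Finset.sum_congr rfl fun j _ => Finset.sum_comm.trans <|
      Finset.sum_congr rfl fun i _ => Finset.sum_congr rfl fun k _ => mul_comm _ _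

/-- An algebraic tensor is a sum over any family whose span contains a suitable finite set. -/
theorem exists_finset_tensor_eq_sum {E F : Type*} [AddCommGroup E] [Module ℝ E] [AddCommGroup F]
    [Module ℝ F] (ξ : E ⊗[ℝ] F) :
    ∃ S : Finset F, ∀ (n : ℕ) (e : Fin n → F), (S : Set F) ⊆ Submodule.span ℝ (Set.range e) →
      ∃ h : Fin n → E, ξ = ∑ i, h i ⊗ₜ[ℝ] e i := by
  classical
  induction ξ using TensorProduct.induction_on with
  | zero => exact ⟨∅, fun n e _ => ⟨0, by simp⟩⟩
  | tmul x y =>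
    refine ⟨{y}, fun n e hS => ?_⟩
    have hy : y ∈ Submodule.span ℝ (Set.range e) := hS (by simp)
    obtain ⟨c, rfl⟩ := (Submodule.mem_span_range_iff_exists_fun ℝ).1 hy
    exact ⟨fun i => c i • x, by simp [TensorProduct.tmul_sum, TensorProduct.smul_tmul]⟩
  | add ξ η hξ hη =>
    obtain ⟨S, hS⟩ := hξ
    obtain ⟨T, hT⟩ := hη
    refine ⟨S ∪ T, fun n e h => ?_⟩
    rw [Finset.coe_union, Set.union_subset_iff] at h
    obtain ⟨a, rfl⟩ := hS n e h.1
    obtain ⟨b, rfl⟩ := hT n e h.2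
    exact ⟨a + b, by simp [TensorProduct.add_tmul, Finset.sum_add_distrib]⟩

theorem exists_orthonormal_span_superset (S : Finset F) :
    ∃ (n : ℕ) (e : Fin n → F), Orthonormal ℝ e ∧
      (S : Set F) ⊆ Submodule.span ℝ (Set.range e) := by
  let b := stdOrthonormalBasis ℝ (Submodule.span ℝ (S : Set F))
  refine ⟨_, fun i => (b i : F), b.orthonormal.comp_linearIsometry
    (Submodule.span ℝ (S : Set F)).subtypeₗᵢ, fun x hx => ?_⟩
  have hx' : x ∈ Submodule.span ℝ (S : Set F) := Submodule.subset_span hx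
  have := congrArg (Submodule.subtype _) (b.sum_repr ⟨x, hx'⟩)
  simp only [map_sum, map_smul, Submodule.subtype_apply] at this
  rw [← this]
  exact Submodule.sum_mem _ fun i _ => Submodule.smul_mem _ _ (Submodule.subset_span ⟨i, rfl⟩)

theorem PencilFormNonneg.of_isPositive {n : ℕ} {A : Fin g → E →L[ℝ] E} {X : Fin g → F →L[ℝ] F}
    (hA : ∀ j x y, inner ℝ (A j x) y = inner ℝ x (A j y))
    (hX : ∀ j x y, inner ℝ (X j x) y = inner ℝ x (X j y))
    (h : (monicPencilEval A X).IsPositive) {e : Fin n → F} (he : Orthonormal ℝ e) :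
    PencilFormNonneg A fun j i k => inner ℝ (X j (e i)) (e k) := fun w => by
  rw [← pencil_quadratic_form_sum he]
  exact (isPositive_monicPencilEval_iff hA hX).1 h _

theorem isPositive_monicPencilEval_of_forall_orthonormal {A : Fin g → E →L[ℝ] E}
    {X : Fin g → F →L[ℝ] F} (hA : ∀ j x y, inner ℝ (A j x) y = inner ℝ x (A j y))
    (hX : ∀ j x y, inner ℝ (X j x) y = inner ℝ x (X j y))
    (h : ∀ (n : ℕ) (e : Fin n → F), Orthonormal ℝ e →
      PencilFormNonneg A fun j i k => inner ℝ (X j (e i)) (e k)) :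
    (monicPencilEval A X).IsPositive := by
  rw [isPositive_monicPencilEval_iff hA hX]
  intro ξ
  obtain ⟨S, hS⟩ := exists_finset_tensor_eq_sum ξ
  obtain ⟨n, e, he, hSe⟩ := exists_orthonormal_span_superset S
  obtain ⟨w, rfl⟩ := hS n e hSe
  rw [pencil_quadratic_form_sum he]
  exact h n e he w

theorem isPositive_monicPencilEval_of_orthonormalBasis {n : ℕ} {A : Fin g → E →L[ℝ] E}
    {X : Fin g → F →L[ℝ] F} (hA : ∀ j x y, inner ℝ (A j x) y = inner ℝ x (A j y))
    (hX : ∀ j x y, inner ℝ (X j x) y = inner ℝ x (X j y)) (b : OrthonormalBasis (Fin n) ℝ F)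
    (h : PencilFormNonneg A fun j i k => inner ℝ (X j (b i)) (b k)) :
    (monicPencilEval A X).IsPositive := by
  rw [isPositive_monicPencilEval_iff hA hX]
  intro ξ
  obtain ⟨S, hS⟩ := exists_finset_tensor_eq_sum ξ
  obtain ⟨w, rfl⟩ := hS n b (by
    rw [← b.coe_toBasis, b.toBasis.span_eq]
    exact fun _ _ => trivial)
  rw [pencil_quadratic_form_sum b.orthonormal]
  exact h w

/-- Symmetric matrices are the matrices of self-adjoint operators on the span of an orthonormal
family. -/
theorem exists_closedSubmodule_matrix_realization {n : ℕ} [CompleteSpace F] {e : Fin n → F}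
    (he : Orthonormal ℝ e) {Y : Fin g → Matrix (Fin n) (Fin n) ℝ} (hY : ∀ j, (Y j).IsSymm) :
    ∃ (K : ClosedSubmodule ℝ F) (b : OrthonormalBasis (Fin n) ℝ K.toSubmodule)
      (X : Fin g → K.toSubmodule →L[ℝ] K.toSubmodule), (∀ j, IsSelfAdjoint (X j)) ∧
      ∀ j i k, inner ℝ (X j (b i)) (b k) = Y j i k := by
  have := FiniteDimensional.span_of_finite ℝ (Set.finite_range e)
  let K : ClosedSubmodule ℝ F :=
    { Submodule.span ℝ (Set.range e) with
      isClosed' := (Submodule.span ℝ (Set.range e)).closed_of_finiteDimensional }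
  have hmem : ∀ i, e i ∈ K.toSubmodule := fun i => Submodule.subset_span ⟨i, rfl⟩
  let v : Fin n → K.toSubmodule := fun i => ⟨e i, hmem i⟩
  have hv : Orthonormal ℝ v := by
    rw [orthonormal_iff_ite] at he ⊢
    exact fun i k => he i k
  have hsp : ⊤ ≤ Submodule.span ℝ (Set.range v) := by
    rintro ⟨x, hx⟩ -
    obtain ⟨c, hc⟩ := (Submodule.mem_span_range_iff_exists_fun ℝ).1 hx
    exact (Submodule.mem_span_range_iff_exists_fun ℝ).2 ⟨c, Subtype.ext (by simpa [v] using hc)⟩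
  have : CompleteSpace K.toSubmodule := ClosedSubmodule.instCompleteSpaceToSubmodule K
  let b := OrthonormalBasis.mk hv hsp
  let X : Fin g → K.toSubmodule →L[ℝ] K.toSubmodule := fun j =>
    ∑ i, ∑ k, Y j i k • (innerSL ℝ (v i)).smulRight (v k)
  have hX : ∀ j x y, inner ℝ (X j x) y =
      ∑ i, ∑ k, Y j i k * (inner ℝ (v i) x * inner ℝ (v k) y) := fun j x y => by
    simp [X, sum_inner, inner_smul_left]
  refine ⟨K, b, X, fun j => ?_, fun j i k => ?_⟩
  · rw [ContinuousLinearMap.isSelfAdjoint_iff_isSymmetric]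
    intro x y
    rw [ContinuousLinearMap.coe_coe, real_inner_comm (X j y), hX, hX, Finset.sum_comm]
    refine Finset.sum_congr rfl fun i _ => Finset.sum_congr rfl fun k _ => ?_
    rw [(hY j).apply i k]
    ring
  · simp [hX, b, orthonormal_iff_ite.1 hv]

end Positivity

/-! ### Matrices of operators acting on a direct sum -/

section MatrixOperator

/-- The Hilbert space direct sum `E ^ n`. -/
def HilbertPower (n : ℕ) (E : Type*) : Type _ := PiLp 2 (fun _ : Fin n => E)

variable {n : ℕ} {E : Type*} [NormedAddCommGroup E] [InnerProductSpace ℝ E]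

instance : NormedAddCommGroup (HilbertPower n E) :=
  inferInstanceAs (NormedAddCommGroup (PiLp 2 (fun _ : Fin n => E)))

instance : InnerProductSpace ℝ (HilbertPower n E) :=
  inferInstanceAs (InnerProductSpace ℝ (PiLp 2 (fun _ : Fin n => E)))

instance [CompleteSpace E] : CompleteSpace (HilbertPower n E) :=
  inferInstanceAs (CompleteSpace (PiLp 2 (fun _ : Fin n => E)))

namespace HilbertPower

/-- The vector of `E ^ n` with given coordinates. -/
def mk : (Fin n → E) ≃ₗ[ℝ] HilbertPower n E := (WithLp.linearEquiv 2 ℝ (Fin n → E)).symm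

/-- A coordinate of a vector of `E ^ n`. -/
def coord (i : Fin n) : HilbertPower n E →L[ℝ] E :=
  LinearMap.mkContinuous
    { toFun := fun x => WithLp.ofLp (p := 2) (V := Fin n → E) x i
      map_add' := fun _ _ => rfl
      map_smul' := fun _ _ => rfl } 1 fun x => by
    rw [one_mul]
    exact PiLp.norm_apply_le (p := 2) (β := fun _ : Fin n => E) x i

/-- The inclusion of a direct summand into `E ^ n`. -/
def single (i : Fin n) : E →L[ℝ] HilbertPower n E :=
  LinearMap.mkContinuous (mk.toLinearMap ∘ₗ LinearMap.single ℝ (fun _ => E) i) 1 fun x => by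
    rw [one_mul]
    exact (PiLp.norm_single 2 (fun _ : Fin n => E) i x).le

theorem coord_single (i k : Fin n) (h : E) : coord i (single k h) = if i = k then h else 0 := by
  change (Pi.single k h : Fin n → E) i = _
  rw [Pi.single_apply]

theorem norm_coord_le (i : Fin n) (x : HilbertPower n E) : ‖coord i x‖ ≤ ‖x‖ :=
  PiLp.norm_apply_le (p := 2) (β := fun _ : Fin n => E) x i

theorem norm_single (i : Fin n) (h : E) : ‖single i h‖ = ‖h‖ := by
  have : ‖single i h‖ = ‖PiLp.single 2 (β := fun _ : Fin n => E) i h‖ := rfl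
  rw [this, PiLp.norm_single]

theorem inner_eq_sum (x y : HilbertPower n E) :
    inner ℝ x y = ∑ i, inner ℝ (coord i x) (coord i y) :=
  PiLp.inner_apply (𝕜 := ℝ) (f := fun _ : Fin n => E) x y

theorem ext_coord {x y : HilbertPower n E} (h : ∀ i, coord i x = coord i y) : x = y :=
  PiLp.ext (p := 2) (α := fun _ : Fin n => E) h

end HilbertPower

open HilbertPower

/-- The operator on `E ^ n` of a matrix of operators on `E`, as a linear map in the matrix. -/
def matrixOperatorLinear : Matrix (Fin n) (Fin n) (E →L[ℝ] E) →ₗ[ℝ]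
    (HilbertPower n E →L[ℝ] HilbertPower n E) where
  toFun M := ∑ i, ∑ k, (single i).comp ((M i k).comp (coord k))
  map_add' M N := by simp [Finset.sum_add_distrib]
  map_smul' c M := by simp [Finset.smul_sum]

theorem coord_matrixOperatorLinear (M : Matrix (Fin n) (Fin n) (E →L[ℝ] E))
    (x : HilbertPower n E) (i : Fin n) :
    coord i (matrixOperatorLinear M x) = ∑ k, M i k (coord k x) := by
  simp [matrixOperatorLinear, coord_single]

/-- A matrix of operators on `E` as an operator on `E ^ n`. -/
def matrixOperator : Matrix (Fin n) (Fin n) (E →L[ℝ] E) →ₐ[ℝ]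
    (HilbertPower n E →L[ℝ] HilbertPower n E) :=
  AlgHom.ofLinearMap matrixOperatorLinear
    (by
      ext x
      refine ext_coord fun i => ?_
      rw [coord_matrixOperatorLinear, Finset.sum_eq_single i]
      · simp
      · intro k _ hk
        simp [Matrix.one_apply_ne' hk]
      · simp)
    (fun M N => by
      ext x
      refine ext_coord fun i => ?_
      simp only [coord_matrixOperatorLinear, mul_apply_eq_comp,
        Matrix.mul_apply, sum_apply, map_sum]
      exact Finset.sum_comm)

@[simp]
theorem coord_matrixOperator (M : Matrix (Fin n) (Fin n) (E →L[ℝ] E))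
    (x : HilbertPower n E) (i : Fin n) :
    coord i (matrixOperator M x) = ∑ k, M i k (coord k x) :=
  coord_matrixOperatorLinear M x i

theorem inner_matrixOperator (M : Matrix (Fin n) (Fin n) (E →L[ℝ] E))
    (x y : HilbertPower n E) :
    inner ℝ (matrixOperator M x) y = ∑ i, ∑ k, inner ℝ (M i k (coord k x)) (coord i y) := by
  simp [inner_eq_sum, sum_inner]

theorem norm_entry_le_norm_matrixOperator (M : Matrix (Fin n) (Fin n) (E →L[ℝ] E))
    (i k : Fin n) : ‖M i k‖ ≤ ‖matrixOperator M‖ := by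
  refine ContinuousLinearMap.opNorm_le_bound _ (norm_nonneg _) fun h => ?_
  have h1 : coord i (matrixOperator M (single k h)) = M i k h := by
    simp [coord_single, apply_ite]
  calc ‖M i k h‖ ≤ ‖matrixOperator M (single k h)‖ := h1 ▸ norm_coord_le i _
    _ ≤ ‖matrixOperator M‖ * ‖single k h‖ := ContinuousLinearMap.le_opNorm _ _
    _ = _ := by rw [norm_single]

theorem isSelfAdjoint_matrixOperator [CompleteSpace E]
    {M : Matrix (Fin n) (Fin n) (E →L[ℝ] E)} (hM : M.IsHermitian) :
    IsSelfAdjoint (matrixOperator M) := by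
  rw [ContinuousLinearMap.isSelfAdjoint_iff_isSymmetric]
  intro x y
  simp only [ContinuousLinearMap.coe_coe]
  rw [real_inner_comm (matrixOperator M y), inner_matrixOperator, inner_matrixOperator,
    Finset.sum_comm]
  refine Finset.sum_congr rfl fun i _ => Finset.sum_congr rfl fun k _ => ?_
  rw [← hM.apply, ContinuousLinearMap.star_eq_adjoint, ContinuousLinearMap.adjoint_inner_left,
    real_inner_comm]

/-- `‖M - T‖ ≤ M` if `0 ≤ T` and `‖T‖ ≤ M`. -/
theorem norm_norm_smul_one_sub_le {F : Type*} [NormedAddCommGroup F] [InnerProductSpace ℝ F]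
    {T : F →L[ℝ] F} (hT : T.IsPositive) : ‖‖T‖ • (1 : F →L[ℝ] F) - T‖ ≤ ‖T‖ := by
  have hs : ((‖T‖ • (1 : F →L[ℝ] F) - T : F →L[ℝ] F) : F →ₗ[ℝ] F).IsSymmetric := fun x y => by
    have := hT.isSymmetric x y
    simp only [ContinuousLinearMap.coe_coe] at this
    simp [inner_sub_left, inner_sub_right, inner_smul_left, inner_smul_right, this]
  -- The norm of a symmetric operator is the supremum of its absolute Rayleigh quotients, which here
  -- lie between `0` and `‖T‖`.
  rw [ContinuousLinearMap.norm_eq_iSup_rayleighQuotient _ hs]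
  refine ciSup_le fun x => ?_
  rw [ContinuousLinearMap.rayleighQuotient, ContinuousLinearMap.reApplyInnerSelf_apply, abs_div,
    abs_sq]
  refine div_le_of_le_mul₀ (by positivity) (norm_nonneg _) ?_
  have h0 : 0 ≤ inner ℝ (T x) x := hT.inner_nonneg_left x
  have h1 : inner ℝ (T x) x ≤ ‖T‖ * ‖x‖ ^ 2 := by
    calc inner ℝ (T x) x ≤ ‖T x‖ * ‖x‖ := real_inner_le_norm _ _
      _ ≤ ‖T‖ * ‖x‖ * ‖x‖ := by gcongr; exact T.le_opNorm x
      _ = _ := by ring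
  have h2 : inner ℝ ((‖T‖ • (1 : F →L[ℝ] F) - T) x) x = ‖T‖ * ‖x‖ ^ 2 - inner ℝ (T x) x := by
    simp [inner_sub_left, inner_smul_left]
  rw [RCLike.re_to_real, h2, abs_of_nonneg (by linarith)]
  linarith

end MatrixOperator

/-! ### Complete positivity of `*`-homomorphisms -/

section CompletePositivity

variable {n : ℕ} {H : Type*} [NormedAddCommGroup H] [InnerProductSpace ℝ H] [CompleteSpace H]
    {G : Type*} [NormedAddCommGroup G] [InnerProductSpace ℝ G] [CompleteSpace G]
    {𝒜 : StarSubalgebra ℝ (H →L[ℝ] H)}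

/-- A matrix over a subalgebra of `B(H)` as an operator on `H ^ n`. -/
def subalgebraMatrixOperator (𝒜 : StarSubalgebra ℝ (H →L[ℝ] H)) (n : ℕ) :
    Matrix (Fin n) (Fin n) 𝒜 →ₐ[ℝ]
      (HilbertPower n H →L[ℝ] HilbertPower n H) :=
  matrixOperator.comp 𝒜.subtype.toAlgHom.mapMatrix

/-- The inverse has to lie in the matrices over `𝒜`, not merely in `B(H ^ n)`. The Neumann series
converges entrywise there: entries are bounded by the operator norm, and a closed `𝒜` is complete.
-/
theorem isUnit_one_sub_of_norm_matrixOperator_lt_one (h𝒜 : IsClosed (𝒜 : Set (H →L[ℝ] H)))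
    {S : Matrix (Fin n) (Fin n) 𝒜} (hS : ‖subalgebraMatrixOperator 𝒜 n S‖ < 1) :
    IsUnit (1 - S) := by
  have : CompleteSpace 𝒜 := h𝒜.completeSpace_coe
  have hent : ∀ (m : ℕ) i k, ‖(S ^ m) i k‖ ≤ ‖subalgebraMatrixOperator 𝒜 n S‖ ^ m := by
    intro m i k
    calc ‖(S ^ m) i k‖ ≤ ‖subalgebraMatrixOperator 𝒜 n (S ^ m)‖ :=
          norm_entry_le_norm_matrixOperator (𝒜.subtype.toAlgHom.mapMatrix (S ^ m)) i k
      _ ≤ _ := by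
        rw [map_pow]
        rcases m.eq_zero_or_pos with rfl | hm
        -- The exponent zero is separate because the identity of a trivial space has norm `0`; only
        -- `‖1‖ ≤ 1` is available.
        · rw [pow_zero, pow_zero]
          exact ContinuousLinearMap.norm_id_le
        · exact norm_pow_le' _ hm
  have hsum : Summable (S ^ ·) := by
    refine Pi.summable.2 fun i => Pi.summable.2 fun k => ?_
    exact Summable.of_norm_bounded (summable_geometric_of_lt_one (norm_nonneg _) hS)
      fun m => hent m i k
  exact ⟨⟨_, _, hsum.one_sub_mul_tsum_pow, hsum.tsum_pow_mul_one_sub⟩, rfl⟩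

/-- The norm of a self-adjoint operator is its real spectral radius. Algebra homomorphisms do not
enlarge the spectrum, and the Neumann series bounds the spectrum of `S` over `𝒜` by its operator
norm. No continuity of `π` is assumed. -/
theorem norm_map_matrix_le (h𝒜 : IsClosed (𝒜 : Set (H →L[ℝ] H))) (π : 𝒜 →⋆ₐ[ℝ] (G →L[ℝ] G))
    {S : Matrix (Fin n) (Fin n) 𝒜} (hS : S.IsHermitian) :
    ‖matrixOperator (π.toAlgHom.mapMatrix S)‖ ≤ ‖subalgebraMatrixOperator 𝒜 n S‖ := by
  have hsa : IsSelfAdjoint (matrixOperator (π.toAlgHom.mapMatrix S)) :=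
    isSelfAdjoint_matrixOperator (hS.map _ fun a => map_star π a)
  have hr := ContinuousLinearMap.spectralRadius_eq_nnnorm _ hsa
  suffices h : spectralRadius ℝ (matrixOperator (π.toAlgHom.mapMatrix S)) ≤
      ‖subalgebraMatrixOperator 𝒜 n S‖₊ by
    rw [hr] at h
    exact_mod_cast h
  refine iSup₂_le fun k hk => ?_
  have hk' : k ∈ spectrum ℝ S :=
    AlgHom.spectrum_apply_subset (matrixOperator.comp π.toAlgHom.mapMatrix) S hk
  by_contra! hlt
  have hlt' : ‖subalgebraMatrixOperator 𝒜 n S‖ < ‖k‖ := by exact_mod_cast hlt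
  have hk0 : k ≠ 0 := by
    rintro rfl
    simp only [norm_zero] at hlt'
    exact absurd hlt' (norm_nonneg _).not_gt
  refine hk' ?_
  have hu : IsUnit (1 - k⁻¹ • S) := isUnit_one_sub_of_norm_matrixOperator_lt_one h𝒜 (by
    rw [map_smul, norm_smul, norm_inv]
    exact (inv_mul_lt_one₀ (by positivity)).2 hlt')
  have := hu.smul (Units.mk0 k hk0)
  rw [Units.smul_mk0, smul_sub, smul_smul, mul_inv_cancel₀ hk0, one_smul,
    ← Algebra.algebraMap_eq_smul_one] at this
  exact this

/-- Unital `*`-homomorphisms on closed `*`-algebras of operators are completely positive. -/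
theorem sum_inner_map_nonneg (h𝒜 : IsClosed (𝒜 : Set (H →L[ℝ] H))) (π : 𝒜 →⋆ₐ[ℝ] (G →L[ℝ] G))
    {T : Matrix (Fin n) (Fin n) 𝒜} (hT : T.IsHermitian)
    (hpos : ∀ h : Fin n → H, 0 ≤ ∑ i, ∑ k, inner ℝ ((T i k : H →L[ℝ] H) (h k)) (h i))
    (v : Fin n → G) : 0 ≤ ∑ i, ∑ k, inner ℝ (π (T i k) (v k)) (v i) := by
  set Θ := subalgebraMatrixOperator 𝒜 n
  have hP : (Θ T).IsPositive := by
    rw [ContinuousLinearMap.isPositive_iff']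
    refine ⟨isSelfAdjoint_matrixOperator (hT.map _ fun a => rfl), fun x => ?_⟩
    exact (inner_matrixOperator _ x x).symm ▸ hpos fun i => HilbertPower.coord i x
  set M := ‖Θ T‖
  have hS : (M • 1 - T).IsHermitian := (by
    rw [Matrix.IsHermitian, Matrix.conjTranspose_sub, hT.eq, Matrix.conjTranspose_smul,
      star_trivial, Matrix.conjTranspose_one])
  have h1 := (norm_map_matrix_le h𝒜 π hS).trans (c := M) (by
    have := norm_norm_smul_one_sub_le hP
    rwa [← map_one Θ, ← map_smul, ← map_sub] at this)
  let x : HilbertPower n G := HilbertPower.mk v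
  have h2 : inner ℝ (matrixOperator (π.toAlgHom.mapMatrix T) x) x =
      ∑ i, ∑ k, inner ℝ (π (T i k) (v k)) (v i) := inner_matrixOperator _ x x
  rw [← h2]
  -- Writing `T = M - (M - T)` turns the bound `‖π (M - T)‖ ≤ M` into positivity of the image of
  -- `T`.
  have h3 : matrixOperator (π.toAlgHom.mapMatrix T) x =
      M • x - matrixOperator (π.toAlgHom.mapMatrix (M • 1 - T)) x := by
    rw [map_sub, map_sub, map_smul, map_smul, map_one, map_one]
    simp
  rw [h3, inner_sub_left, inner_smul_left, real_inner_self_eq_norm_sq, sub_nonneg]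
  calc _ ≤ ‖matrixOperator (π.toAlgHom.mapMatrix (M • 1 - T)) x‖ * ‖x‖ := real_inner_le_norm _ _
    _ ≤ M * ‖x‖ * ‖x‖ := by
      gcongr
      exact (ContinuousLinearMap.le_opNorm _ _).trans
        (mul_le_mul_of_nonneg_right h1 (norm_nonneg x))
    _ = _ := by simp; ring

/-- The matrix over an algebra given by a pencil `1 + ∑ j, A j x j` at a tuple of matrices. -/
def pencilMatrix {g : ℕ} {R : Type*} [Ring R] [Algebra ℝ R] (A : Fin g → R)
    (Y : Fin g → Matrix (Fin n) (Fin n) ℝ) : Matrix (Fin n) (Fin n) R :=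
  1 + ∑ j, (Y j)ᵀ.map fun c => c • A j

/-- The transpose in `pencilMatrix` reconciles two index orders: an operator matrix applies its `(i,
k)` entry to the `k`-th vector, whereas the pencil form applies `A j` to the `i`-th. Taking `ρ` as
the inclusion or as `π` covers both sides of complete positivity. -/
theorem sum_inner_pencilMatrix {g : ℕ} {R : Type*} [Ring R] [Algebra ℝ R] {L : Type*}
    [NormedAddCommGroup L] [InnerProductSpace ℝ L] (ρ : R →ₐ[ℝ] (L →L[ℝ] L)) (A : Fin g → R)
    (Y : Fin g → Matrix (Fin n) (Fin n) ℝ) (w : Fin n → L) :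
    ∑ i, ∑ k, inner ℝ (ρ (pencilMatrix A Y i k) (w k)) (w i) =
      ∑ i, inner ℝ (w i) (w i) + ∑ j, ∑ i, ∑ k, Y j i k * inner ℝ (ρ (A j) (w i)) (w k) := by
  have h : ∀ i k, inner ℝ (ρ (pencilMatrix A Y i k) (w k)) (w i) =
      (if i = k then inner ℝ (w k) (w i) else 0) +
        ∑ j, Y j k i * inner ℝ (ρ (A j) (w k)) (w i) := fun i k => by
    simp only [pencilMatrix, Matrix.add_apply, Matrix.sum_apply, Matrix.map_apply,
      Matrix.transpose_apply, Matrix.one_apply, map_add, map_sum, map_smul, add_apply, sum_apply,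
      smul_apply, inner_add_left, sum_inner, inner_smul_left, RCLike.conj_to_real]
    split_ifs <;> simp
  simp only [h, Finset.sum_add_distrib, Finset.sum_ite_eq, Finset.mem_univ, if_true]
  congr 1
  rw [Finset.sum_comm, Finset.sum_comm (s := Finset.univ (α := Fin g))]
  exact Finset.sum_congr rfl fun k _ => Finset.sum_comm

theorem PencilFormNonneg.map {g : ℕ} {A : Fin g → 𝒜} {Y : Fin g → Matrix (Fin n) (Fin n) ℝ}
    (h𝒜 : IsClosed (𝒜 : Set (H →L[ℝ] H))) (π : 𝒜 →⋆ₐ[ℝ] (G →L[ℝ] G))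
    (hA : ∀ j, IsSelfAdjoint (A j)) (hY : ∀ j, (Y j).IsSymm)
    (h : PencilFormNonneg (fun j => (A j : H →L[ℝ] H)) Y) :
    PencilFormNonneg (fun j => π (A j)) Y := by
  have hT : (pencilMatrix A Y).IsHermitian := by
    rw [pencilMatrix, Matrix.IsHermitian, Matrix.conjTranspose_add, Matrix.conjTranspose_one,
      Matrix.conjTranspose_sum]
    congr 1
    refine Finset.sum_congr rfl fun j _ => ?_
    ext1 i k
    simp [(hA j).star_eq, (hY j).apply]
  intro v
  have := sum_inner_map_nonneg h𝒜 π hT (fun w => ?_) v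
  · exact (sum_inner_pencilMatrix π.toAlgHom A Y v) ▸ this
  · exact (sum_inner_pencilMatrix 𝒜.subtype.toAlgHom A Y w).symm ▸ h w

end CompletePositivity

/-! ### Compressions and the polar condition -/

section Compression

variable {g : ℕ} {H : Type*} [NormedAddCommGroup H] [InnerProductSpace ℝ H] [CompleteSpace H]
    {𝒦 : Type*} [NormedAddCommGroup 𝒦] [InnerProductSpace ℝ 𝒦] [CompleteSpace 𝒦]
    {W : Type*} [NormedAddCommGroup W] [InnerProductSpace ℝ W] [CompleteSpace W]
    {G : Type*} [NormedAddCommGroup G] [InnerProductSpace ℝ G] [CompleteSpace G]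

/-- The coefficient terms at `w` equal those of `T` at `V w`, while the identity term only grows,
since `‖V w‖ ≤ ‖w‖`. -/
theorem PencilFormNonneg.compression {n : ℕ} {T : Fin g → G →L[ℝ] G}
    {Y : Fin g → Matrix (Fin n) (Fin n) ℝ} (h : PencilFormNonneg T Y) {V : W →L[ℝ] G}
    (hV : ‖V‖ ≤ 1) :
    PencilFormNonneg (fun j => (ContinuousLinearMap.adjoint V).comp ((T j).comp V)) Y := by
  intro w
  refine (h fun i => V (w i)).trans ?_
  simp only [ContinuousLinearMap.comp_apply, ContinuousLinearMap.adjoint_inner_left]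
  gcongr with i
  rw [real_inner_self_eq_norm_sq, real_inner_self_eq_norm_sq]
  gcongr
  exact V.le_of_opNorm_le_of_le hV le_rfl |>.trans_eq (one_mul _)

theorem compression_mem_polarDualAt {𝒜 : StarSubalgebra ℝ (H →L[ℝ] H)}
    (h𝒜 : IsClosed (𝒜 : Set (H →L[ℝ] H))) {a : Fin g → 𝒜} (ha : ∀ j, IsSelfAdjoint (a j))
    (π : 𝒜 →⋆ₐ[ℝ] (G →L[ℝ] G)) {V : W →L[ℝ] G} (hV : ‖V‖ ≤ 1) :
    (fun j => (ContinuousLinearMap.adjoint V).comp ((π (a j)).comp V)) ∈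
      polarDualAt (operSpectrahedron (fun j => (a j : H →L[ℝ] H)) 𝒦) W := by
  have hsa : ∀ j, IsSelfAdjoint ((ContinuousLinearMap.adjoint V).comp ((π (a j)).comp V)) :=
    fun j => ((ha j).map π).adjoint_conj V
  refine ⟨hsa, fun K Y hY => ?_⟩
  have hYs : ∀ j x y, inner ℝ (Y j x) y = inner ℝ x (Y j y) := fun j =>
    (ContinuousLinearMap.isSelfAdjoint_iff_isSymmetric.1 (hY.1 j))
  refine isPositive_monicPencilEval_of_forall_orthonormal
    (fun j => ContinuousLinearMap.isSelfAdjoint_iff_isSymmetric.1 (hsa j)) hYs fun n e he => ?_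
  refine PencilFormNonneg.compression (PencilFormNonneg.map h𝒜 π ha (fun j => ?_) ?_) hV
  · exact Matrix.IsSymm.ext fun i k => by rw [hYs, real_inner_comm]
  · exact PencilFormNonneg.of_isPositive
      (fun j => ContinuousLinearMap.isSelfAdjoint_iff_isSymmetric.1 ((ha j).map 𝒜.subtype))
      hYs hY.2 he

/-- The polar dual tests only operators on subspaces of `𝒦`. The family `e` provides an
`n`-dimensional subspace on which `Y` becomes an admissible tuple. -/
theorem PencilFormNonneg.of_mem_polarDualAt {n : ℕ} {A : Fin g → H →L[ℝ] H}
    (hA : ∀ j, IsSelfAdjoint (A j)) {B : Fin g → W →L[ℝ] W}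
    (hB : B ∈ polarDualAt (operSpectrahedron A 𝒦) W) {e : Fin n → 𝒦} (he : Orthonormal ℝ e)
    {Y : Fin g → Matrix (Fin n) (Fin n) ℝ} (hY : ∀ j, (Y j).IsSymm) (h : PencilFormNonneg A Y) :
    PencilFormNonneg B Y := by
  obtain ⟨K, b, X, hX, hXY⟩ := exists_closedSubmodule_matrix_realization he hY
  have hXY' : Y = fun j i k => inner ℝ (X j (b i)) (b k) := by
    ext j i k
    exact (hXY j i k).symm
  have hs : ∀ j x y, inner ℝ (X j x) y = inner ℝ x (X j y) := fun j =>
    ContinuousLinearMap.isSelfAdjoint_iff_isSymmetric.1 (hX j)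
  rw [hXY'] at h ⊢
  refine PencilFormNonneg.of_isPositive
    (fun j => ContinuousLinearMap.isSelfAdjoint_iff_isSymmetric.1 (hB.1 j)) hs
    (hB.2 K X ⟨hX, ?_⟩) b.orthonormal
  exact isPositive_monicPencilEval_of_orthonormalBasis
    (fun j => ContinuousLinearMap.isSelfAdjoint_iff_isSymmetric.1 (hA j)) hs b h

end Compression

/-! ### Contractions of matrices with Gram matrices -/

section MatrixForm

variable {n : ℕ} {U : Type*} [AddCommGroup U] [Module ℝ U]

/-- The contraction of a matrix with the Gram matrix of a family with respect to a bilinear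
form. -/
def gramSum (β : U →ₗ[ℝ] U →ₗ[ℝ] ℝ) (h : Fin n → U) : Matrix (Fin n) (Fin n) ℝ →ₗ[ℝ] ℝ where
  toFun X := ∑ i, ∑ k, X i k * β (h i) (h k)
  map_add' X Y := by simp [add_mul, Finset.sum_add_distrib]
  map_smul' c X := by simp [Finset.mul_sum, mul_assoc]

theorem gramSum_apply (β : U →ₗ[ℝ] U →ₗ[ℝ] ℝ) (h : Fin n → U) (X : Matrix (Fin n) (Fin n) ℝ) :
    gramSum β h X = ∑ i, ∑ k, X i k * β (h i) (h k) := rfl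

theorem gramSum_transpose {β : U →ₗ[ℝ] U →ₗ[ℝ] ℝ} (hβ : ∀ x y, β x y = β y x) (h : Fin n → U)
    (X : Matrix (Fin n) (Fin n) ℝ) : gramSum β h Xᵀ = gramSum β h X := by
  rw [gramSum_apply, gramSum_apply, Finset.sum_comm]
  exact Finset.sum_congr rfl fun i _ => Finset.sum_congr rfl fun k _ => by
    rw [hβ, Matrix.transpose_apply]

theorem gramSum_one (β : U →ₗ[ℝ] U →ₗ[ℝ] ℝ) (h : Fin n → U) :
    gramSum β h 1 = ∑ i, β (h i) (h i) := by
  simp [gramSum_apply, Matrix.one_apply]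

/-- Congruence of the coefficient matrix is the same as a linear change of the vectors; this drives
the homogenization. -/
theorem gramSum_conj (β : U →ₗ[ℝ] U →ₗ[ℝ] ℝ) (h : Fin n → U) (D X : Matrix (Fin n) (Fin n) ℝ) :
    gramSum β h (Dᵀ * X * D) = gramSum β (fun i => ∑ k, D i k • h k) X := by
  simp only [gramSum_apply, Matrix.mul_apply, Matrix.transpose_apply, map_sum, map_smul,
    LinearMap.sum_apply, LinearMap.smul_apply, smul_eq_mul, Finset.sum_mul, Finset.mul_sum]
  calc _ = ∑ a, ∑ b, ∑ c, ∑ d, D d a * X d c * D c b * β (h a) (h b) := rfl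
    _ = ∑ d, ∑ c, ∑ a, ∑ b, D d a * X d c * D c b * β (h a) (h b) := by
      rw [Finset.sum_congr rfl fun a _ => Finset.sum_congr rfl fun b _ => Finset.sum_comm]
      rw [Finset.sum_congr rfl fun a _ => Finset.sum_comm, Finset.sum_comm]
      refine Finset.sum_congr rfl fun d _ => ?_
      rw [Finset.sum_congr rfl fun a _ => Finset.sum_comm, Finset.sum_comm]
    _ = _ := by
      refine Finset.sum_congr rfl fun d _ => Finset.sum_congr rfl fun c _ => ?_
      rw [Finset.sum_comm]
      refine Finset.sum_congr rfl fun b _ => Finset.sum_congr rfl fun a _ => by ring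

open scoped MatrixOrder Matrix.Norms.L2Operator in
theorem exists_eq_transpose_mul_self_of_posDef {S : Matrix (Fin n) (Fin n) ℝ} (hS : S.PosDef) :
    ∃ D : Matrix (Fin n) (Fin n) ℝ, IsUnit D ∧ S = Dᵀ * D := by
  obtain ⟨D, hD⟩ := CStarAlgebra.nonneg_iff_eq_star_mul_self.mp hS.posSemidef.nonneg
  rw [Matrix.star_eq_conjTranspose, Matrix.conjTranspose_eq_transpose_of_trivial] at hD
  refine ⟨D, ?_, hD⟩
  have := hS.isUnit
  rw [Matrix.isUnit_iff_isUnit_det, hD, Matrix.det_mul] at this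
  rw [Matrix.isUnit_iff_isUnit_det]
  exact isUnit_of_mul_isUnit_right this

end MatrixForm

/-! ### Homogenization of the polar condition -/

section MatrixPolar

variable {g n : ℕ} {H : Type*} [NormedAddCommGroup H] [InnerProductSpace ℝ H] [CompleteSpace H]
    {W : Type*} [NormedAddCommGroup W] [InnerProductSpace ℝ W] [CompleteSpace W]

/-- The bilinear form of a bounded operator. -/
def operatorForm {E : Type*} [NormedAddCommGroup E] [InnerProductSpace ℝ E] (T : E →L[ℝ] E) :
    E →ₗ[ℝ] E →ₗ[ℝ] ℝ := (innerₗ E).comp (T : E →ₗ[ℝ] E)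

@[simp]
theorem operatorForm_apply {E : Type*} [NormedAddCommGroup E] [InnerProductSpace ℝ E]
    (T : E →L[ℝ] E) (x y : E) : operatorForm T x y = inner ℝ (T x) y := rfl

theorem operatorForm_symm {T : W →L[ℝ] W} (hT : IsSelfAdjoint T) (x y : W) :
    operatorForm T x y = operatorForm T y x := by
  rw [operatorForm_apply, operatorForm_apply, real_inner_comm x]
  exact ContinuousLinearMap.isSelfAdjoint_iff_isSymmetric.1 hT x y

theorem pencilFormNonneg_iff_gramSum {E : Type*} [NormedAddCommGroup E] [InnerProductSpace ℝ E]
    {A : Fin g → E →L[ℝ] E} {Y : Fin g → Matrix (Fin n) (Fin n) ℝ} :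
    PencilFormNonneg A Y ↔ ∀ h : Fin n → E,
      0 ≤ gramSum (operatorForm 1) h 1 + ∑ j, gramSum (operatorForm (A j)) h (Y j) := by
  simp only [gramSum_one]
  rfl

/-- The symmetric part of a matrix. -/
def symmPart (M : Matrix (Fin n) (Fin n) ℝ) : Matrix (Fin n) (Fin n) ℝ := (2⁻¹ : ℝ) • (M + Mᵀ)

theorem isSymm_symmPart (M : Matrix (Fin n) (Fin n) ℝ) : (symmPart M).IsSymm := by
  rw [Matrix.IsSymm, symmPart, Matrix.transpose_smul, Matrix.transpose_add,
    Matrix.transpose_transpose, add_comm]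

theorem gramSum_symmPart {T : W →L[ℝ] W} (hT : IsSelfAdjoint T) (h : Fin n → W)
    (M : Matrix (Fin n) (Fin n) ℝ) :
    gramSum (operatorForm T) h (symmPart M) = gramSum (operatorForm T) h M := by
  simp only [symmPart, map_smul, map_add, gramSum_transpose (operatorForm_symm hT), smul_eq_mul]
  ring

theorem nonneg_of_forall_pos_add_mul_nonneg {a c : ℝ} (h : ∀ ε > 0, 0 ≤ a + ε * c) : 0 ≤ a := by
  have h1 : Filter.Tendsto (fun ε : ℝ => a + ε * c) (nhdsWithin 0 (Set.Ioi 0)) (nhds a) := by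
    have : Continuous fun ε : ℝ => a + ε * c := by fun_prop
    simpa using (this.tendsto 0).mono_left nhdsWithin_le_nhds
  exact ge_of_tendsto h1 (Filter.eventually_of_mem self_mem_nhdsWithin h)

/-- The inhomogeneous polar condition for matrix coefficients implies the homogeneous one. -/
theorem gramSum_nonneg_of_pencilFormNonneg {A : Fin g → H →L[ℝ] H} {B : Fin g → W →L[ℝ] W}
    (hA : ∀ j, IsSelfAdjoint (A j)) (hB : ∀ j, IsSelfAdjoint (B j))
    (hAB : ∀ Y : Fin g → Matrix (Fin n) (Fin n) ℝ, (∀ j, (Y j).IsSymm) →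
      PencilFormNonneg A Y → PencilFormNonneg B Y)
    {t : Matrix (Fin n) (Fin n) ℝ} {X : Fin g → Matrix (Fin n) (Fin n) ℝ}
    (ht : ∀ c : Fin n → ℝ, 0 ≤ gramSum (operatorForm 1) c t)
    (hX : ∀ h : Fin n → H,
      0 ≤ gramSum (operatorForm 1) h t + ∑ j, gramSum (operatorForm (A j)) h (X j))
    (w : Fin n → W) :
    0 ≤ gramSum (operatorForm 1) w t + ∑ j, gramSum (operatorForm (B j)) w (X j) := by
  -- Adding `ε • 1` makes the semidefinite `t` invertible; the extra term is `ε * ∑ i, ‖w i‖ ^ 2`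
  -- and vanishes in the limit.
  refine nonneg_of_forall_pos_add_mul_nonneg (c := gramSum (operatorForm 1) w 1) fun ε hε => ?_
  -- Neither `t` nor `X` need be symmetric, but forms of self-adjoint operators see only the
  -- symmetric part.
  set S : Matrix (Fin n) (Fin n) ℝ := symmPart t + ε • 1 with hSdef
  have hSsymm : S.IsSymm := (isSymm_symmPart t).add (Matrix.isSymm_one.smul ε)
  have hS : S.PosDef := by
    refine Matrix.PosDef.of_dotProduct_mulVec_pos 
      ((Matrix.conjTranspose_eq_transpose_of_trivial S).trans hSsymm.eq) fun c hc => ?_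
    have h1 : star c ⬝ᵥ S *ᵥ c = gramSum (operatorForm 1) c S := by
      simp only [dotProduct, Matrix.mulVec, gramSum_apply, operatorForm_apply, Finset.mul_sum]
      refine Finset.sum_congr rfl fun i _ => Finset.sum_congr rfl fun k _ => ?_
      simp
      ring
    have h2 : 0 < gramSum (operatorForm (1 : ℝ →L[ℝ] ℝ)) c 1 := by
      rw [gramSum_one]
      obtain ⟨i, hi⟩ := Function.ne_iff.1 hc
      exact Finset.sum_pos' (fun i _ => real_inner_self_nonneg (x := c i))
        ⟨i, Finset.mem_univ i, real_inner_self_pos.2 hi⟩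
    rw [h1, hSdef, map_add, map_smul, gramSum_symmPart (.one _), smul_eq_mul]
    have := ht c
    positivity
  obtain ⟨D, hD, hSD⟩ := exists_eq_transpose_mul_self_of_posDef hS
  obtain ⟨C, hDC, hCD⟩ := isUnit_iff_exists.1 hD
  have hDC' : Dᵀ * Cᵀ = 1 := by rw [← Matrix.transpose_mul, hCD, Matrix.transpose_one]
  -- With `S = Dᵀ * D` and `C` inverse to `D`, congruence by `C` takes the pencil with leading
  -- coefficient `S` to a monic one.
  set Y : Fin g → Matrix (Fin n) (Fin n) ℝ := fun j => Cᵀ * symmPart (X j) * C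
  have hY : ∀ j, Dᵀ * Y j * D = symmPart (X j) := fun j => by
    calc Dᵀ * Y j * D = (Dᵀ * Cᵀ) * symmPart (X j) * (C * D) := by simp only [Y, Matrix.mul_assoc]
      _ = _ := by rw [hDC', hCD, Matrix.one_mul, Matrix.mul_one]
  have hYs : ∀ j, (Y j).IsSymm := fun j => by
    rw [Matrix.IsSymm, Matrix.transpose_mul, Matrix.transpose_mul, Matrix.transpose_transpose,
      (isSymm_symmPart (X j)).eq, ← Matrix.mul_assoc]
  have hAY : PencilFormNonneg A Y := by
    rw [pencilFormNonneg_iff_gramSum]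
    intro h
    have h1 := hX fun i => ∑ k, C i k • h k
    have h2 : ∀ j, gramSum (operatorForm (A j)) h (Y j) =
        gramSum (operatorForm (A j)) (fun i => ∑ k, C i k • h k) (X j) := fun j => by
      rw [gramSum_conj, gramSum_symmPart (hA j)]
    have h3 : gramSum (operatorForm 1) h 1 =
        gramSum (operatorForm (1 : H →L[ℝ] H)) (fun i => ∑ k, C i k • h k) t +
          ε * gramSum (operatorForm 1) (fun i => ∑ k, C i k • h k) 1 := by
      have : (1 : Matrix (Fin n) (Fin n) ℝ) = Cᵀ * S * C := by
        calc (1 : Matrix (Fin n) (Fin n) ℝ) = (Cᵀ * Dᵀ) * (D * C) := by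
              rw [← Matrix.transpose_mul, hDC, Matrix.transpose_one, Matrix.one_mul]
          _ = _ := by rw [hSD]; simp only [Matrix.mul_assoc]
      rw [this, gramSum_conj, ← this, hSdef, map_add, map_smul, gramSum_symmPart (.one _),
        smul_eq_mul]
    have h4 : 0 ≤ gramSum (operatorForm (1 : H →L[ℝ] H)) (fun i => ∑ k, C i k • h k) 1 := by
      rw [gramSum_one]
      exact Finset.sum_nonneg fun i _ => real_inner_self_nonneg
    simp only [h2, h3]
    nlinarith
  have hBY := pencilFormNonneg_iff_gramSum.1 (hAB Y hYs hAY) fun i => ∑ k, D i k • w k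
  have h5 : gramSum (operatorForm (1 : W →L[ℝ] W)) (fun i => ∑ k, D i k • w k) 1 =
      gramSum (operatorForm 1) w t + ε * gramSum (operatorForm 1) w 1 := by
    rw [← gramSum_conj, Matrix.mul_one, ← hSD, hSdef, map_add, map_smul, gramSum_symmPart (.one _),
      smul_eq_mul]
  have h6 : ∀ j, gramSum (operatorForm (B j)) (fun i => ∑ k, D i k • w k) (Y j) =
      gramSum (operatorForm (B j)) w (X j) := fun j => by
    rw [← gramSum_conj, hY, gramSum_symmPart (hB j)]
  simp only [h5, h6] at hBY
  linarith

end MatrixPolar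

/-! ### Extension of positive functionals -/

section Extension

/-- A linear functional which is nonnegative on the nonnegative functions in the image of `ι`
extends to a positive functional on a space of functions dominated by the image. -/
theorem exists_positive_extension {Ω M : Type*} [AddCommGroup M] [Module ℝ M]
    (E : Submodule ℝ (Ω → ℝ)) (ι : M →ₗ[ℝ] (Ω → ℝ)) (hι : ∀ m, ι m ∈ E) (f : M →ₗ[ℝ] ℝ)
    (hf : ∀ m, 0 ≤ ι m → 0 ≤ f m) (hdom : ∀ F ∈ E, ∃ m, F ≤ ι m) :
    ∃ s : E →ₗ[ℝ] ℝ, (∀ m, s ⟨ι m, hι m⟩ = f m) ∧ ∀ F : E, 0 ≤ (F : Ω → ℝ) → 0 ≤ s F := by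
  let ι' : M →ₗ[ℝ] E := ι.codRestrict E hι
  -- If `ι m = 0`, positivity applies to both `m` and `-m`; hence `f` descends to the image of `ι`.
  have hker : LinearMap.ker ι' ≤ LinearMap.ker f := fun m hm => by
    have hm0 : ι m = 0 := congrArg Subtype.val (LinearMap.mem_ker.1 hm)
    have h1 := hf m hm0.ge
    have h2 := hf (-m) (by rw [map_neg, hm0, neg_zero])
    rw [map_neg] at h2
    exact LinearMap.mem_ker.2 (by linarith)
  let f₀ : E →ₗ.[ℝ] ℝ :=
    ⟨LinearMap.range ι', (LinearMap.ker ι').liftQ f hker ∘ₗ ι'.quotKerEquivRange.symm.toLinearMap⟩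
  have hf₀ : ∀ m (h : ι' m ∈ LinearMap.range ι'), f₀ ⟨ι' m, h⟩ = f m := fun m h => by
    change (LinearMap.ker ι').liftQ f hker (ι'.quotKerEquivRange.symm ⟨ι' m, h⟩) = f m
    rw [LinearMap.quotKerEquivRange_symm_apply_image]
    rfl
  obtain ⟨s, hs, hs'⟩ := riesz_extension ((PointedCone.positive ℝ (Ω → ℝ)).comap E.subtype) f₀
    (by
      rintro ⟨_, m, rfl⟩ hx
      exact (hf m hx).trans_eq (hf₀ m ⟨m, rfl⟩).symm)
    (fun y => by
      -- A majorant of `-y` in the image gives the cofinality that the Riesz theorem requires.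
      obtain ⟨m, hm⟩ := hdom (-y : E) (-y).2
      refine ⟨⟨ι' m, m, rfl⟩, ?_⟩
      have h : 0 ≤ ι m + (y : Ω → ℝ) := by
        have := add_le_add_left hm (y : Ω → ℝ)
        simpa using this
      exact h)
  exact ⟨s, fun m => (hs ⟨ι' m, m, rfl⟩).trans (hf₀ m _), fun F hF => hs' F hF⟩

end Extension

/-! ### The function space and the positive functional of `B` -/

section FormSpace

variable {g : ℕ} {H : Type*} [NormedAddCommGroup H] [InnerProductSpace ℝ H]
    {W : Type*} [NormedAddCommGroup W] [InnerProductSpace ℝ W]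

/-- The bilinear form `(w, w') ↦ ⟪T (x w), x w'⟫` of an operator `T` and a linear map `x`. -/
def pullbackForm (T : H →L[ℝ] H) (x : W →ₗ[ℝ] H) : W ⊗[ℝ] W →ₗ[ℝ] ℝ :=
  TensorProduct.lift ((operatorForm T).compl₁₂ x x)

@[simp]
theorem pullbackForm_tmul (T : H →L[ℝ] H) (x : W →ₗ[ℝ] H) (w w' : W) :
    pullbackForm T x (w ⊗ₜ w') = inner ℝ (T (x w)) (x w') := rfl

theorem pullbackForm_sum {n : ℕ} (T : H →L[ℝ] H) (x : W →ₗ[ℝ] H) (e : Fin n → W)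
    (M : Matrix (Fin n) (Fin n) ℝ) :
    pullbackForm T x (∑ i, ∑ k, M i k • (e i ⊗ₜ[ℝ] e k)) =
      gramSum (operatorForm T) (fun i => x (e i)) M := by
  simp [gramSum_apply]

/-- The bilinear form of a linear map `W → H ⊕ ℝ`. -/
def dominatingForm (ω : (W →ₗ[ℝ] H) × (W →ₗ[ℝ] ℝ)) : W ⊗[ℝ] W →ₗ[ℝ] ℝ :=
  pullbackForm 1 ω.1 + pullbackForm 1 ω.2

theorem dominatingForm_tmul_self (ω : (W →ₗ[ℝ] H) × (W →ₗ[ℝ] ℝ)) (w : W) :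
    dominatingForm ω (w ⊗ₜ w) = ‖ω.1 w‖ ^ 2 + ‖ω.2 w‖ ^ 2 := by
  rw [← real_inner_self_eq_norm_sq, ← real_inner_self_eq_norm_sq]
  rfl

variable (H W) in
/-- The functions on the space of linear maps `W → H ⊕ ℝ` which are dominated by the quadratic
form of a finite rank tensor. -/
def dominatedFunctions : Submodule ℝ ((W →ₗ[ℝ] H) × (W →ₗ[ℝ] ℝ) → ℝ) where
  carrier := {F | ∃ t : W ⊗[ℝ] W, ∀ ω, |F ω| ≤ dominatingForm ω t}
  zero_mem' := ⟨0, by simp⟩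
  add_mem' := by
    rintro F F' ⟨t, ht⟩ ⟨t', ht'⟩
    refine ⟨t + t', fun ω => ?_⟩
    rw [map_add]
    exact (abs_add_le _ _).trans (add_le_add (ht ω) (ht' ω))
  smul_mem' := by
    rintro c F ⟨t, ht⟩
    refine ⟨|c| • t, fun ω => ?_⟩
    rw [map_smul, Pi.smul_apply, smul_eq_mul, abs_mul, smul_eq_mul]
    exact mul_le_mul_of_nonneg_left (ht ω) (abs_nonneg c)

theorem abs_inner_apply_le {E : Type*} [NormedAddCommGroup E] [InnerProductSpace ℝ E]
    (T : E →L[ℝ] E) (x y : E) : |inner ℝ (T x) y| ≤ ‖T‖ ^ 2 * ‖x‖ ^ 2 + ‖y‖ ^ 2 := by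
  have h1 := abs_real_inner_le_norm (T x) y
  have h2 := T.le_opNorm x
  have h3 : ‖T x‖ ^ 2 ≤ (‖T‖ * ‖x‖) ^ 2 := by gcongr
  nlinarith [sq_nonneg (‖T x‖ - ‖y‖), sq_nonneg (‖T x‖), sq_nonneg ‖y‖]

theorem pullbackForm_fst_mem (T : H →L[ℝ] H) (t : W ⊗[ℝ] W) :
    (fun ω => pullbackForm T ω.1 t) ∈ dominatedFunctions H W := by
  induction t using TensorProduct.induction_on with
  | zero => exact (dominatedFunctions H W).zero_mem
  | add s t hs ht => simpa using! (dominatedFunctions H W).add_mem hs ht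
  | tmul w w' =>
    refine ⟨‖T‖ ^ 2 • (w ⊗ₜ w) + w' ⊗ₜ w', fun ω => ?_⟩
    rw [map_add, map_smul, dominatingForm_tmul_self, dominatingForm_tmul_self, smul_eq_mul]
    refine (abs_inner_apply_le T (ω.1 w) (ω.1 w')).trans ?_
    have : 0 ≤ ‖T‖ ^ 2 * ‖ω.2 w‖ ^ 2 + ‖ω.2 w'‖ ^ 2 := by positivity
    linarith

theorem pullbackForm_snd_mem (t : W ⊗[ℝ] W) :
    (fun ω => pullbackForm 1 ω.2 t) ∈ dominatedFunctions H W := by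
  induction t using TensorProduct.induction_on with
  | zero => exact (dominatedFunctions H W).zero_mem
  | add s t hs ht => simpa using! (dominatedFunctions H W).add_mem hs ht
  | tmul w w' =>
    refine ⟨w ⊗ₜ w + w' ⊗ₜ w', fun ω => ?_⟩
    rw [map_add, dominatingForm_tmul_self, dominatingForm_tmul_self]
    refine (abs_inner_apply_le 1 (ω.2 w) (ω.2 w')).trans ?_
    have : 0 ≤ ‖ω.1 w‖ ^ 2 + ‖ω.1 w'‖ ^ 2 := by positivity
    rw [norm_one]
    linarith

/-- Stating this for every family spanning a finite set lets `t` and all the `X j` be expanded in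
one common orthonormal family. -/
theorem exists_finset_tensor_eq_matrix_sum (T : W ⊗[ℝ] W) :
    ∃ S : Finset W, ∀ (n : ℕ) (e : Fin n → W), (S : Set W) ⊆ Submodule.span ℝ (Set.range e) →
      ∃ M : Matrix (Fin n) (Fin n) ℝ, T = ∑ i, ∑ k, M i k • (e i ⊗ₜ[ℝ] e k) := by
  classical
  induction T using TensorProduct.induction_on with
  | zero => exact ⟨∅, fun n e _ => ⟨0, by simp⟩⟩
  | tmul x y =>
    refine ⟨{x, y}, fun n e hS => ?_⟩
    have hx : x ∈ Submodule.span ℝ (Set.range e) := hS (by simp)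
    have hy : y ∈ Submodule.span ℝ (Set.range e) := hS (by simp)
    obtain ⟨c, rfl⟩ := (Submodule.mem_span_range_iff_exists_fun ℝ).1 hx
    obtain ⟨d, rfl⟩ := (Submodule.mem_span_range_iff_exists_fun ℝ).1 hy
    exact ⟨Matrix.of fun i k => c i * d k, by
      rw [TensorProduct.sum_tmul]
      refine Finset.sum_congr rfl fun i _ => ?_
      rw [TensorProduct.tmul_sum]
      exact Finset.sum_congr rfl fun k _ => TensorProduct.smul_tmul_smul _ _ _ _⟩
  | add ξ η hξ hη =>
    obtain ⟨S, hS⟩ := hξ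
    obtain ⟨T, hT⟩ := hη
    refine ⟨S ∪ T, fun n e h => ?_⟩
    rw [Finset.coe_union, Set.union_subset_iff] at h
    obtain ⟨a, rfl⟩ := hS n e h.1
    obtain ⟨b, rfl⟩ := hT n e h.2
    exact ⟨a + b, by simp [add_smul, Finset.sum_add_distrib]⟩

/-- Linear maps realize arbitrary vectors along `e`, so pointwise nonnegativity of a pencil function
becomes a matrix inequality for all vectors. -/
theorem exists_linearMap_apply_orthonormal {n : ℕ} {e : Fin n → W} (he : Orthonormal ℝ e)
    {L : Type*} [AddCommGroup L] [Module ℝ L] (h : Fin n → L) :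
    ∃ x : W →ₗ[ℝ] L, ∀ i, x (e i) = h i :=
  ⟨∑ i, (innerₗ W (e i)).smulRight (h i), fun i => by
    simp [orthonormal_iff_ite.1 he]⟩

/-- The function on linear maps `W → H ⊕ ℝ` of an element `(t, X)` of the homogenized pencil. -/
def pencilFunction (A : Fin g → H →L[ℝ] H) :
    (W ⊗[ℝ] W) × (Fin g → W ⊗[ℝ] W) →ₗ[ℝ] ((W →ₗ[ℝ] H) × (W →ₗ[ℝ] ℝ) → ℝ) :=
  LinearMap.pi fun ω => (dominatingForm ω).coprod (LinearMap.lsum ℝ (fun _ => W ⊗[ℝ] W) ℝ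
    fun j => pullbackForm (A j) ω.1)

theorem pencilFunction_apply (A : Fin g → H →L[ℝ] H) (m : (W ⊗[ℝ] W) × (Fin g → W ⊗[ℝ] W))
    (ω : (W →ₗ[ℝ] H) × (W →ₗ[ℝ] ℝ)) :
    pencilFunction A m ω = dominatingForm ω m.1 + ∑ j, pullbackForm (A j) ω.1 (m.2 j) := by
  simp [pencilFunction, LinearMap.lsum_apply]

theorem pencilFunction_mem (A : Fin g → H →L[ℝ] H) (m : (W ⊗[ℝ] W) × (Fin g → W ⊗[ℝ] W)) :
    pencilFunction A m ∈ dominatedFunctions H W := by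
  have : pencilFunction A m =
      (fun ω => pullbackForm 1 ω.1 m.1) + (fun ω => pullbackForm 1 ω.2 m.1) +
      ∑ j, fun ω : (W →ₗ[ℝ] H) × (W →ₗ[ℝ] ℝ) => pullbackForm (A j) ω.1 (m.2 j) := by
    ext ω
    simp [pencilFunction_apply, dominatingForm]
  rw [this]
  exact add_mem (add_mem (pullbackForm_fst_mem 1 _) (pullbackForm_snd_mem _))
    (sum_mem fun j _ => pullbackForm_fst_mem _ _)

/-- The functional on the homogenized pencil given by a tuple of operators. -/
def pencilFunctional (B : Fin g → W →L[ℝ] W) : (W ⊗[ℝ] W) × (Fin g → W ⊗[ℝ] W) →ₗ[ℝ] ℝ :=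
  (pullbackForm 1 LinearMap.id).coprod
    (LinearMap.lsum ℝ (fun _ => W ⊗[ℝ] W) ℝ fun j => pullbackForm (B j) LinearMap.id)

theorem pencilFunctional_apply (B : Fin g → W →L[ℝ] W)
    (m : (W ⊗[ℝ] W) × (Fin g → W ⊗[ℝ] W)) :
    pencilFunctional B m =
      pullbackForm 1 LinearMap.id m.1 + ∑ j, pullbackForm (B j) LinearMap.id (m.2 j) := by
  simp [pencilFunctional, LinearMap.lsum_apply]

theorem pencilFunctional_nonneg [CompleteSpace H] [CompleteSpace W] {A : Fin g → H →L[ℝ] H}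
    {B : Fin g → W →L[ℝ] W} (hA : ∀ j, IsSelfAdjoint (A j)) (hB : ∀ j, IsSelfAdjoint (B j))
    (hAB : ∀ (n : ℕ) (e : Fin n → W), Orthonormal ℝ e →
      ∀ Y : Fin g → Matrix (Fin n) (Fin n) ℝ, (∀ j, (Y j).IsSymm) →
      PencilFormNonneg A Y → PencilFormNonneg B Y)
    (m : (W ⊗[ℝ] W) × (Fin g → W ⊗[ℝ] W)) (hm : 0 ≤ pencilFunction A m) :
    0 ≤ pencilFunctional B m := by
  classical
  obtain ⟨t, X⟩ := m
  obtain ⟨S, hS⟩ := exists_finset_tensor_eq_matrix_sum t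
  choose R hR using fun j => exists_finset_tensor_eq_matrix_sum (X j)
  obtain ⟨n, e, he, hSe⟩ := exists_orthonormal_span_superset (S ∪ Finset.univ.biUnion R)
  rw [Finset.coe_union, Set.union_subset_iff] at hSe
  obtain ⟨t', rfl⟩ := hS n e hSe.1
  choose X' hX' using fun j => hR j n e (fun w hw => hSe.2 (by
    simp only [Finset.coe_biUnion, Set.mem_iUnion]
    exact ⟨j, by simp, hw⟩))
  obtain rfl : X = fun j => _ := funext hX'
  rw [pencilFunctional_apply]
  simp only [pullbackForm_sum]
  have hm' := fun ω => hm ω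
  simp only [Pi.zero_apply, pencilFunction_apply, dominatingForm, LinearMap.add_apply,
    pullbackForm_sum] at hm'
  refine gramSum_nonneg_of_pencilFormNonneg hA hB (hAB n e he) (fun c => ?_) (fun h => ?_) _
  -- At `(0, φ)` only the scalar form of `t` survives; at `(x, 0)` the full pencil in `A` does.
  · obtain ⟨φ, hφ⟩ := exists_linearMap_apply_orthonormal he c
    have := hm' (0, φ)
    simpa [hφ, gramSum_apply] using this
  · obtain ⟨x, hx⟩ := exists_linearMap_apply_orthonormal he h
    have := hm' (x, 0)
    simpa [hx, gramSum_apply] using this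

theorem exists_positive_functional [CompleteSpace H] [CompleteSpace W] {A : Fin g → H →L[ℝ] H}
    {B : Fin g → W →L[ℝ] W} (hA : ∀ j, IsSelfAdjoint (A j)) (hB : ∀ j, IsSelfAdjoint (B j))
    (hAB : ∀ (n : ℕ) (e : Fin n → W), Orthonormal ℝ e →
      ∀ Y : Fin g → Matrix (Fin n) (Fin n) ℝ, (∀ j, (Y j).IsSymm) →
      PencilFormNonneg A Y → PencilFormNonneg B Y) :
    ∃ s : dominatedFunctions H W →ₗ[ℝ] ℝ, 
      (∀ F : dominatedFunctions H W, 0 ≤ (F : (W →ₗ[ℝ] H) × (W →ₗ[ℝ] ℝ) → ℝ) → 0 ≤ s F) ∧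
      (∀ w, s ⟨_, pullbackForm_fst_mem 1 (w ⊗ₜ w)⟩ ≤ ‖w‖ ^ 2) ∧
      ∀ j w w', s ⟨_, pullbackForm_fst_mem (A j) (w ⊗ₜ w')⟩ = inner ℝ (B j w) w' := by
  classical
  obtain ⟨s, hs, hpos⟩ := exists_positive_extension (dominatedFunctions H W) (pencilFunction A)
    (pencilFunction_mem A) (pencilFunctional B) (pencilFunctional_nonneg hA hB hAB)
    (fun F ⟨t, ht⟩ => ⟨(t, 0), fun ω => by
      simpa [pencilFunction_apply] using (le_abs_self _).trans (ht ω)⟩)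
  refine ⟨s, hpos, fun w => ?_, fun j w w' => ?_⟩
  · have h1 := hs (w ⊗ₜ w, 0)
    -- The difference is `‖ω.2 w‖ ^ 2`, and `s` takes the value `‖w‖ ^ 2` on the minuend; dropping
    -- the scalar summand therefore costs an inequality.
    have h2 := hpos (⟨_, pencilFunction_mem A (w ⊗ₜ w, 0)⟩ -
      ⟨_, pullbackForm_fst_mem 1 (w ⊗ₜ w)⟩) (fun ω => by
        simp [pencilFunction_apply, dominatingForm, sq_nonneg])
    rw [map_sub, h1] at h2
    simpa [pencilFunctional_apply] using h2
  · have h1 := hs (0, Pi.single j (w ⊗ₜ w'))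
    have h2 : pencilFunctional B (0, Pi.single j (w ⊗ₜ w')) = inner ℝ (B j w) w' := by
      rw [pencilFunctional_apply, Finset.sum_eq_single j] <;> simp +contextual
    rw [← h2, ← h1]
    congr 2
    ext ω
    rw [pencilFunction_apply, Finset.sum_eq_single j] <;> simp +contextual

end FormSpace

/-! ### The GNS construction -/

section GNS

universe w

/-- The Hilbert space of a positive semidefinite bilinear form. -/
theorem exists_hilbert_completion {P : Type w} [AddCommGroup P] [Module ℝ P]
    (β : P →ₗ[ℝ] P →ₗ[ℝ] ℝ) (hsymm : ∀ x y, β x y = β y x) (hpos : ∀ x, 0 ≤ β x x) :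
    ∃ (G : Type w) (_ : NormedAddCommGroup G) (_ : InnerProductSpace ℝ G) (_ : CompleteSpace G)
      (J : P →ₗ[ℝ] G), DenseRange J ∧ (∀ x y, inner ℝ (J x) (J y) = β x y) ∧
      ∀ (T : P →ₗ[ℝ] P) (C : ℝ), 0 ≤ C → (∀ x, β (T x) (T x) ≤ C ^ 2 * β x x) →
        ∃ T' : G →L[ℝ] G, ∀ x, T' (J x) = J (T x) := by
  let core : PreInnerProductSpace.Core ℝ P :=
    { inner := fun x y => β x y
      conj_inner_symm := fun x y => hsymm y x
      re_inner_nonneg := fun x => hpos x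
      add_left := fun x y z => by simp
      smul_left := fun x y r => by simp }
  let : SeminormedAddCommGroup P := InnerProductSpace.Core.toSeminormedAddCommGroup (𝕜 := ℝ)
  let : InnerProductSpace ℝ P := .ofCore _
  have hinner : ∀ x y : P, inner ℝ x y = β x y := fun _ _ => rfl
  refine ⟨UniformSpace.Completion P, inferInstance, inferInstance, inferInstance,
    (UniformSpace.Completion.toComplL (𝕜 := ℝ) (E := P)).toLinearMap,
    UniformSpace.Completion.denseRange_coe,
    fun x y => UniformSpace.Completion.inner_coe x y, fun T C hC hT => ?_⟩
  let T₁ : P →L[ℝ] P := LinearMap.mkContinuous T C fun x => by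
    rw [← sq_le_sq₀ (norm_nonneg _) (by positivity), mul_pow, ← real_inner_self_eq_norm_sq,
      ← real_inner_self_eq_norm_sq]
    exact hT x
  exact ⟨T₁.completion, fun x => T₁.completion_apply_coe x⟩

/-- The representation on the Hilbert space of a positive semidefinite form which is compatible
with an action of a `*`-algebra. -/
theorem exists_gns_representation {R : Type*} [Ring R] [StarRing R] [Algebra ℝ R] {P : Type w}
    [AddCommGroup P] [Module ℝ P] (ρ : R →ₐ[ℝ] Module.End ℝ P) (β : P →ₗ[ℝ] P →ₗ[ℝ] ℝ)
    (hsymm : ∀ x y, β x y = β y x) (hpos : ∀ x, 0 ≤ β x x)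
    (hρ : ∀ a x y, β (ρ a x) y = β x (ρ (star a) y)) (c : R → ℝ) (hc : ∀ a, 0 ≤ c a)
    (hbd : ∀ a x, β (ρ a x) (ρ a x) ≤ c a ^ 2 * β x x) :
    ∃ (G : Type w) (_ : NormedAddCommGroup G) (_ : InnerProductSpace ℝ G) (_ : CompleteSpace G)
      (π : R →⋆ₐ[ℝ] (G →L[ℝ] G)) (J : P →ₗ[ℝ] G), DenseRange J ∧
      (∀ x y, inner ℝ (J x) (J y) = β x y) ∧ (∀ a x, π a (J x) = J (ρ a x)) ∧
      ∀ a, ‖π a‖ ≤ c a := by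
  obtain ⟨G, _, _, _, J, hJ, hJβ, hext⟩ := exists_hilbert_completion β hsymm hpos
  choose π hπ using fun a => hext (ρ a) (c a) (hc a) (hbd a)
  -- The operators `π a` are chosen one at a time; density of the range of `J` forces the algebraic
  -- identities among them.
  have huniq : ∀ S T : G →L[ℝ] G, (∀ x, S (J x) = T (J x)) → S = T := fun S T h =>
    ContinuousLinearMap.ext fun y =>
      congrFun (hJ.equalizer S.continuous T.continuous (funext h)) y
  refine ⟨G, _, _, _,
    { toFun := π
      map_one' := huniq _ _ fun x => by simp [hπ]
      map_mul' := fun a b => huniq _ _ fun x => by simp [hπ]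
      map_zero' := huniq _ _ fun x => by simp [hπ]
      map_add' := fun a b => huniq _ _ fun x => by simp [hπ]
      commutes' := fun r => huniq _ _ fun x => by simp [hπ]
      map_star' := fun a => huniq _ _ fun x => ?_ }, J, hJ, hJβ, hπ,
    fun a => ?_⟩
  · refine ext_inner_right ℝ fun y => ?_
    refine congrFun (hJ.equalizer (g := fun y => inner ℝ (π (star a) (J x)) y)
      (h := fun y => inner ℝ ((star (π a)) (J x)) y) (by fun_prop) (by fun_prop) ?_) y
    ext z
    simp only [Function.comp_apply, ContinuousLinearMap.star_eq_adjoint,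
      ContinuousLinearMap.adjoint_inner_left, hπ, hJβ]
    rw [hρ, star_star]
  · refine ContinuousLinearMap.opNorm_le_bound _ (hc a) fun y => ?_
    refine hJ.induction_on (p := fun y => ‖π a y‖ ≤ c a * ‖y‖) y
      (isClosed_le (by fun_prop) (by fun_prop)) fun x => ?_
    have := hc a
    rw [← sq_le_sq₀ (norm_nonneg _) (by positivity), mul_pow, ← real_inner_self_eq_norm_sq,
      ← real_inner_self_eq_norm_sq, hπ, hJβ, hJβ]
    exact hbd a x

end GNS

/-! ### Dilation of a tuple in the polar dual -/

section Dilation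

universe u v

variable {g : ℕ} {H : Type u} [NormedAddCommGroup H] [InnerProductSpace ℝ H] [CompleteSpace H]
    {W : Type v} [NormedAddCommGroup W] [InnerProductSpace ℝ W]
    {𝒜 : StarSubalgebra ℝ (H →L[ℝ] H)}

/-- The evaluation `a ⊗ w ↦ a (x w)`. -/
def evalTensor (𝒜 : StarSubalgebra ℝ (H →L[ℝ] H)) (x : W →ₗ[ℝ] H) : 𝒜 ⊗[ℝ] W →ₗ[ℝ] H :=
  TensorProduct.lift (LinearMap.mk₂ ℝ (fun a w => (a : H →L[ℝ] H) (x w)) (by simp) (by simp)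
    (by simp) (by simp))

@[simp]
theorem evalTensor_tmul (x : W →ₗ[ℝ] H) (a : 𝒜) (w : W) :
    evalTensor 𝒜 x (a ⊗ₜ w) = (a : H →L[ℝ] H) (x w) := rfl

/-- Left multiplication on `𝒜 ⊗ W`. -/
def leftMulTensor (𝒜 : StarSubalgebra ℝ (H →L[ℝ] H)) (W : Type v) [NormedAddCommGroup W]
    [InnerProductSpace ℝ W] : 𝒜 →ₐ[ℝ] Module.End ℝ (𝒜 ⊗[ℝ] W) :=
  (Module.End.rTensorAlgHom ℝ 𝒜 W).comp (Algebra.lmul ℝ 𝒜)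

@[simp]
theorem leftMulTensor_tmul (a b : 𝒜) (w : W) :
    leftMulTensor 𝒜 W a (b ⊗ₜ w) = (a * b) ⊗ₜ w := rfl

theorem evalTensor_leftMulTensor (x : W →ₗ[ℝ] H) (a : 𝒜) (ξ : 𝒜 ⊗[ℝ] W) :
    evalTensor 𝒜 x (leftMulTensor 𝒜 W a ξ) = (a : H →L[ℝ] H) (evalTensor 𝒜 x ξ) := by
  induction ξ using TensorProduct.induction_on with
  | zero => simp
  | add ξ η hξ hη => simp only [map_add, hξ, hη]
  | tmul b w => simp

theorem inner_evalTensor_mem (ξ η : 𝒜 ⊗[ℝ] W) :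
    (fun ω : (W →ₗ[ℝ] H) × (W →ₗ[ℝ] ℝ) =>
      inner ℝ (evalTensor 𝒜 ω.1 ξ) (evalTensor 𝒜 ω.1 η)) ∈ dominatedFunctions H W := by
  induction ξ using TensorProduct.induction_on with
  | zero =>
    simp only [map_zero, inner_zero_left]
    exact (dominatedFunctions H W).zero_mem
  | add ξ ξ' hξ hξ' => simpa [inner_add_left] using! (dominatedFunctions H W).add_mem hξ hξ'
  | tmul a w =>
    induction η using TensorProduct.induction_on with
    | zero =>
      simp only [map_zero, inner_zero_right]
      exact (dominatedFunctions H W).zero_mem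
    | add η η' hη hη' => simpa [inner_add_right] using! (dominatedFunctions H W).add_mem hη hη'
    | tmul b w' =>
      convert pullbackForm_fst_mem ((star (b : H →L[ℝ] H)) * (a : H →L[ℝ] H)) (w ⊗ₜ[ℝ] w')
        using 2 with ω
      simp [ContinuousLinearMap.star_eq_adjoint, ContinuousLinearMap.adjoint_inner_left]

/-- The bilinear form on `𝒜 ⊗ W` of a functional on the dominated functions. -/
def gnsForm (𝒜 : StarSubalgebra ℝ (H →L[ℝ] H)) (s : dominatedFunctions H W →ₗ[ℝ] ℝ) :
    𝒜 ⊗[ℝ] W →ₗ[ℝ] 𝒜 ⊗[ℝ] W →ₗ[ℝ] ℝ :=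
  LinearMap.mk₂ ℝ (fun ξ η => s ⟨_, inner_evalTensor_mem ξ η⟩)
    (fun ξ ξ' η => by
      rw [← map_add]
      congr 1
      ext ω
      simp [inner_add_left])
    (fun c ξ η => by
      rw [← map_smul]
      congr 1
      ext ω
      simp [inner_smul_left])
    (fun ξ η η' => by
      rw [← map_add]
      congr 1
      ext ω
      simp [inner_add_right])
    (fun c ξ η => by
      rw [← map_smul]
      congr 1
      ext ω
      simp [inner_smul_right])

theorem gnsForm_apply (s : dominatedFunctions H W →ₗ[ℝ] ℝ) (ξ η : 𝒜 ⊗[ℝ] W) :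
    gnsForm 𝒜 s ξ η = s ⟨_, inner_evalTensor_mem ξ η⟩ := rfl

/-- The form `s (⟪evalTensor ξ, evalTensor η⟫)` on `𝒜 ⊗ W` inherits positivity, compatibility with
the adjoint and the bound `‖b‖` from the corresponding pointwise facts in `H`. The map `V` is `w ↦ 1
⊗ w`. The last two conclusions serve the separability of `G`. -/
theorem exists_dilation [CompleteSpace W] (𝒜 : StarSubalgebra ℝ (H →L[ℝ] H)) {a : Fin g → 𝒜}
    {B : Fin g → W →L[ℝ] W} (ha : ∀ j, IsSelfAdjoint (a j)) (hB : ∀ j, IsSelfAdjoint (B j))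
    (hAB : ∀ (n : ℕ) (e : Fin n → W), Orthonormal ℝ e →
      ∀ Y : Fin g → Matrix (Fin n) (Fin n) ℝ, (∀ j, (Y j).IsSymm) →
      PencilFormNonneg (fun j => (a j : H →L[ℝ] H)) Y → PencilFormNonneg B Y) :
    ∃ (G : Type (max u v)) (_ : NormedAddCommGroup G) (_ : InnerProductSpace ℝ G)
      (_ : CompleteSpace G) (π : 𝒜 →⋆ₐ[ℝ] (G →L[ℝ] G)) (V : W →L[ℝ] G),
      ‖V‖ ≤ 1 ∧ (∀ j, B j = (ContinuousLinearMap.adjoint V).comp ((π (a j)).comp V)) ∧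
      (∀ b, ‖π b‖ ≤ ‖b‖) ∧
      Dense (Submodule.span ℝ (Set.range fun p : 𝒜 × W => π p.1 (V p.2)) : Set G) := by
  obtain ⟨s, hs, hs1, hsB⟩ := exists_positive_functional (fun j => (ha j).map 𝒜.subtype) hB hAB
  have hpos : ∀ ξ, 0 ≤ gnsForm 𝒜 s ξ ξ := fun ξ => hs _ fun ω => real_inner_self_nonneg
  have hbd : ∀ (b : 𝒜) ξ, gnsForm 𝒜 s (leftMulTensor 𝒜 W b ξ) (leftMulTensor 𝒜 W b ξ) ≤
      ‖b‖ ^ 2 * gnsForm 𝒜 s ξ ξ := fun b ξ => by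
    rw [← sub_nonneg, gnsForm_apply, gnsForm_apply, ← smul_eq_mul, ← map_smul, ← map_sub]
    refine hs _ fun ω => ?_
    have := (b : H →L[ℝ] H).le_opNorm (evalTensor 𝒜 ω.1 ξ)
    have h2 : ‖(b : H →L[ℝ] H) (evalTensor 𝒜 ω.1 ξ)‖ ^ 2 ≤
      (‖(b : H →L[ℝ] H)‖ * ‖evalTensor 𝒜 ω.1 ξ‖) ^ 2 := by gcongr
    simp only [Pi.zero_apply, Submodule.coe_sub, Submodule.coe_smul, Pi.sub_apply, Pi.smul_apply,
      evalTensor_leftMulTensor, real_inner_self_eq_norm_sq, smul_eq_mul, sub_nonneg]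
    rwa [mul_pow] at h2
  obtain ⟨G, _, _, _, π, J, hJ, hJβ, hπ, hπn⟩ := exists_gns_representation (leftMulTensor 𝒜 W)
    (gnsForm 𝒜 s) (fun ξ η => by
      rw [gnsForm_apply, gnsForm_apply]
      congr 2
      ext ω
      exact real_inner_comm _ _) hpos (fun b ξ η => by
      rw [gnsForm_apply, gnsForm_apply]
      congr 2
      ext ω
      simp [evalTensor_leftMulTensor, ContinuousLinearMap.star_eq_adjoint,
        ContinuousLinearMap.adjoint_inner_right]) (fun b => ‖b‖) (fun b => norm_nonneg b) hbd
  let V : W →L[ℝ] G := LinearMap.mkContinuous (J ∘ₗ TensorProduct.mk ℝ 𝒜 W 1) 1 fun w => by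
    rw [one_mul, ← sq_le_sq₀ (norm_nonneg _) (norm_nonneg _), ← real_inner_self_eq_norm_sq]
    exact (hJβ _ _).trans_le (hs1 w)
  have hV : ∀ w, V w = J (1 ⊗ₜ w) := fun w => rfl
  have hJV : ∀ (b : 𝒜) w, π b (V w) = J (b ⊗ₜ w) := fun b w => by
    rw [hV, hπ, leftMulTensor_tmul, mul_one]
  refine ⟨G, _, _, _, π, V, LinearMap.mkContinuous_norm_le _ zero_le_one _, fun j => ?_,
    hπn, ?_⟩
  · ext w
    refine ext_inner_right ℝ fun w' => ?_
    rw [ContinuousLinearMap.comp_apply, ContinuousLinearMap.adjoint_inner_left,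
      ContinuousLinearMap.comp_apply, hJV, hV, hJβ, ← hsB]
    rfl
  · refine hJ.mono ?_
    rintro _ ⟨ξ, rfl⟩
    induction ξ using TensorProduct.induction_on with
    | zero => simp
    | add ξ η hξ hη =>
      rw [map_add]
      exact Submodule.add_mem _ hξ hη
    | tmul b w => exact Submodule.subset_span ⟨(b, w), hJV b w⟩

end Dilation

/-! ### Polar dual, hull and weak closedness -/

section PolarDual

variable {g : ℕ} {H : Type*} [NormedAddCommGroup H] [InnerProductSpace ℝ H]
    {𝒦 : Type*} [NormedAddCommGroup 𝒦] [InnerProductSpace ℝ 𝒦] [CompleteSpace 𝒦]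
    {W : Type*} [NormedAddCommGroup W] [InnerProductSpace ℝ W] [CompleteSpace W]
    {A : Fin g → H →L[ℝ] H}

/-- The isometry `ι` carries orthonormal families of `W` into `𝒦`, where the polar condition can be
tested; the dilation is applied with `𝒜 = ⊤`. -/
theorem polarDualAt_operSpectrahedron_eq_operConv [CompleteSpace H] (hA : ∀ j, IsSelfAdjoint (A j))
    (ι : W →ₗᵢ[ℝ] 𝒦) : polarDualAt (operSpectrahedron A 𝒦) W = operConv A W := by
  let a : Fin g → (⊤ : StarSubalgebra ℝ (H →L[ℝ] H)) := fun j => ⟨A j, trivial⟩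
  have ha : ∀ j, IsSelfAdjoint (a j) := fun j => Subtype.ext (hA j)
  refine Set.Subset.antisymm (fun B hB => ?_) ?_
  · obtain ⟨G, _, _, _, π, V, hV, hBV, -⟩ := exists_dilation ⊤ ha hB.1 fun n e he Y hY h =>
      PencilFormNonneg.of_mem_polarDualAt hA hB (he.comp_linearIsometry ι) hY h
    let toTop : (H →L[ℝ] H) →⋆ₐ[ℝ] (⊤ : StarSubalgebra ℝ (H →L[ℝ] H)) :=
      (StarAlgHom.id ℝ (H →L[ℝ] H)).codRestrict ⊤ fun _ => trivial
    have htop : ∀ j, (π.comp toTop) (A j) = π (a j) := fun j => rfl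
    refine ⟨G, _, _, _, π.comp toTop, V, hV, fun j => ?_⟩
    rw [htop]
    exact hBV j
  · rintro X ⟨G, _, _, _, π, V, hV, hX⟩
    obtain rfl : X = fun j => _ := funext hX
    exact compression_mem_polarDualAt (a := a) isClosed_univ ha
      (π.comp (⊤ : StarSubalgebra ℝ (H →L[ℝ] H)).subtype) hV

theorem polarDualAt_operSpectrahedron_eq_separableOperConv [CompleteSpace H]
    [TopologicalSpace.SeparableSpace W] (hA : ∀ j, IsSelfAdjoint (A j)) (ι : W →ₗᵢ[ℝ] 𝒦)
    (𝒜 : StarSubalgebra ℝ (H →L[ℝ] H)) (h𝒜 : ∀ j, A j ∈ 𝒜)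
    (hclosed : IsClosed (𝒜 : Set (H →L[ℝ] H)))
    (hsep : TopologicalSpace.IsSeparable (𝒜 : Set (H →L[ℝ] H))) :
    polarDualAt (operSpectrahedron A 𝒦) W = separableOperConv 𝒜 (fun j => ⟨A j, h𝒜 j⟩) W := by
  let a : Fin g → 𝒜 := fun j => ⟨A j, h𝒜 j⟩
  have ha : ∀ j, IsSelfAdjoint (a j) := fun j => Subtype.ext (hA j)
  refine Set.Subset.antisymm (fun B hB => ?_) ?_
  · obtain ⟨G, _, _, _, π, V, hV, hBV, hπ, hdense⟩ := exists_dilation 𝒜 ha hB.1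
      fun n e he Y hY h => PencilFormNonneg.of_mem_polarDualAt hA hB (he.comp_linearIsometry ι) hY h
    have : TopologicalSpace.SeparableSpace 𝒜 := hsep.separableSpace
    let π' : 𝒜 →L[ℝ] (G →L[ℝ] G) := LinearMap.mkContinuous π.toAlgHom.toLinearMap 1 fun b => by
      rw [one_mul]
      exact hπ b
    -- Since `π` is contractive, the vectors spanning a dense subspace of `G` form a continuous
    -- image of the separable space `𝒜 × W`.
    have hcont : Continuous fun p : 𝒜 × W => π p.1 (V p.2) :=
      (π'.continuous.comp continuous_fst).clm_apply (V.continuous.comp continuous_snd)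
    have hG : TopologicalSpace.SeparableSpace G := by
      rw [← TopologicalSpace.isSeparable_univ_iff, ← hdense.closure_eq]
      exact ((TopologicalSpace.isSeparable_range hcont).span (R := ℝ)).closure
    exact ⟨G, _, _, _, hG, π, V, hV, hBV⟩
  · rintro X ⟨G, _, _, _, _, π, V, hV, hX⟩
    obtain rfl : X = fun j => _ := funext hX
    exact compression_mem_polarDualAt (a := a) hclosed ha π hV

/-- For fixed `Y`, `e` and `h` the polar inequality involves only finitely many coefficients `⟪X j
(h i), h k⟫`, each weakly continuous in `X`; self-adjointness is likewise a family of weakly closed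
equations. -/
theorem isWOTClosed_polarDualAt_operSpectrahedron :
    IsWOTClosed (polarDualAt (operSpectrahedron A 𝒦) W) := by
  have hinner : ∀ (j : Fin g) (x y : W),
      Continuous fun X : Fin g → (W →WOT[ℝ] W) => inner ℝ ((X j).toCLM x) y := fun j x y =>
    (ContinuousLinearMapWOT.continuous_inner_apply (continuous_apply j) x y).congr fun X =>
      real_inner_comm _ _
  have hS : {X : Fin g → (W →WOT[ℝ] W) | (fun j => (X j).toCLM) ∈
      polarDualAt (operSpectrahedron A 𝒦) W} =
      {X | (∀ j x y, inner ℝ ((X j).toCLM x) y = inner ℝ x ((X j).toCLM y)) ∧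
        ∀ (K : ClosedSubmodule ℝ 𝒦), ∀ Y ∈ operSpectrahedron A 𝒦 K, ∀ (n : ℕ)
          (e : Fin n → K.toSubmodule), Orthonormal ℝ e → ∀ h : Fin n → W,
          0 ≤ ∑ i, inner ℝ (h i) (h i) + ∑ j, ∑ i, ∑ k,
            inner ℝ (Y j (e i)) (e k) * inner ℝ ((X j).toCLM (h i)) (h k)} := by
    ext X
    have hsa : (∀ j, IsSelfAdjoint (X j).toCLM) ↔
        ∀ j x y, inner ℝ ((X j).toCLM x) y = inner ℝ x ((X j).toCLM y) :=
      forall_congr' fun j => ContinuousLinearMap.isSelfAdjoint_iff_isSymmetric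
    refine (and_congr hsa Iff.rfl).trans (and_congr_right fun hX => ?_)
    refine forall_congr' fun K => forall₂_congr fun Y hY => ?_
    have hYs : ∀ j x y, inner ℝ (Y j x) y = inner ℝ x (Y j y) := fun j =>
      ContinuousLinearMap.isSelfAdjoint_iff_isSymmetric.1 (hY.1 j)
    exact ⟨fun h n e he => PencilFormNonneg.of_isPositive hX hYs h he,
      fun h => isPositive_monicPencilEval_of_forall_orthonormal hX hYs h⟩
  rw [IsWOTClosed, hS]
  refine IsClosed.and ?_ ?_
  · simp only [Set.ofPred_forall]
    refine isClosed_iInter fun j => isClosed_iInter fun x => isClosed_iInter fun y =>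
      isClosed_eq (hinner j x y) ?_
    simp only [real_inner_comm _ x]
    exact hinner j y x
  · simp only [Set.ofPred_forall]
    refine isClosed_iInter fun K => isClosed_iInter fun Y => isClosed_iInter fun _ =>
      isClosed_iInter fun n => isClosed_iInter fun e => isClosed_iInter fun _ =>
      isClosed_iInter fun h => isClosed_le continuous_const ?_
    exact continuous_const.add (continuous_finsetSum _ fun j _ => continuous_finsetSum _ fun i _ =>
      continuous_finsetSum _ fun k _ => continuous_const.mul (hinner j _ _))

end PolarDual

end

theorem theorem1p3 {g : ℕ}
    {H : Type*} [NormedAddCommGroup H] [InnerProductSpace ℝ H] [CompleteSpace H]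
    [TopologicalSpace.SeparableSpace H]
    {𝒦 : Type*} [NormedAddCommGroup 𝒦] [InnerProductSpace ℝ 𝒦] [CompleteSpace 𝒦]
    [TopologicalSpace.SeparableSpace 𝒦]
    (A : Fin g → H →L[ℝ] H) (hA : ∀ j, IsSelfAdjoint (A j)) :
    polarDualAt (operSpectrahedron A 𝒦) 𝒦 = operConv A 𝒦 ∧
    (∀ K : ClosedSubmodule ℝ 𝒦,
      operPolarDual (operSpectrahedron A 𝒦) K = operConv A K.toSubmodule) ∧
    (∀ (𝒜 : StarSubalgebra ℝ (H →L[ℝ] H)) (h𝒜 : ∀ j, A j ∈ 𝒜),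
      IsClosed (𝒜 : Set (H →L[ℝ] H)) →
      TopologicalSpace.IsSeparable (𝒜 : Set (H →L[ℝ] H)) →
      polarDualAt (operSpectrahedron A 𝒦) 𝒦 =
        separableOperConv 𝒜 (fun j => ⟨A j, h𝒜 j⟩) 𝒦) ∧
    IsWOTClosed (operConv A 𝒦) := by
  have h1 : polarDualAt (operSpectrahedron A 𝒦) 𝒦 = operConv A 𝒦 :=
    polarDualAt_operSpectrahedron_eq_operConv hA LinearIsometry.id
  refine ⟨h1, fun K => polarDualAt_operSpectrahedron_eq_operConv hA K.toSubmodule.subtypeₗᵢ,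
    fun 𝒜 h𝒜 hc hs => polarDualAt_operSpectrahedron_eq_separableOperConv hA LinearIsometry.id
      𝒜 h𝒜 hc hs, ?_⟩
  rw [← h1]
  exact isWOTClosed_polarDualAt_operSpectrahedron
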